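/- Let $(V,\langle\cdot,\cdot\rangle)$ be a finite-dimensional Euclidean space and let $R\subset V\setminus\{0\}$ be a reduced root system (a finite set with $\sigma_\alpha(R)=R$ and $R\cap\mathbb R\alpha=\{\pm\alpha\}$ for all $\alpha\in R$, where $\sigma_\alpha(x)=x-2\frac{\langle\alpha,x\rangle}{\langle\alpha,\alpha\rangle}\alpha$). Let $G$ be the finite group generated by the reflections $\sigma_\alpha$, $\alpha\in R$, with identity $e$. Fix $\beta\in V$ with $\langle\alpha,\beta\rangle\neq0$ for all $\alpha\in R$ and put $R_+=\{\alpha\in R:\langle\alpha,\beta\rangle>0\}$. Let $k:R\to\mathbb C$ be $G$-invariant, let $\gamma=\sum_{\alpha\in R_+}k(\alpha)$ and $\delta=\sum_{\alpha\in R_+}|k(\alpha)|$, and assume $\delta<|1+\gamma|$. For $\xi\in V$ let $$T_\xi f(x)=\partial_\xi f(x)+\sum_{\alpha\in R_+}k(\alpha)\langle\alpha,\xi\rangle\frac{f(x)-f(\sigma_\alpha x)}{\langle\alpha,x\rangle}$$ be the Dunkl operator (the quotient being extended by continuity to $\langle\alpha,x\rangle=0$). Let $\mathcal P$ be the space of complex-valued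 polynomials on $V$ and $\mathcal P_n$ its subspace of homogeneous polynomials of degree $n$. For $g\in G$ and $n\ge1$ let $$c_m(g)=\sum_{\substack{(\alpha_1,\dots,\alpha_m)\in R_+^m\\ \sigma_{\alpha_1}\cdots\sigma_{\alpha_m}=g}}k(\alpha_1)\cdots k(\alpha_m)\quad(m\ge1),\qquad c_0(g)=\begin{cases}1,&g=e,\\0,&g\ne e,\end{cases}\qquad C_n(g)=\sum_{m=0}^{\infty}\frac{c_m(g)}{(n+\gamma)^{m+1}},$$ and for $g_1,\dots,g_n\in G$ let $$C(g_1,\dots,g_n)=C_n(g_n)\,C_{n-1}(g_n^{-1}g_{n-1})\cdots C_1(g_2^{-1}g_1).$$ Then there is a unique linear isomorphism $V_k$ of $\mathcal P$ (the Dunkl intertwining operator) with $V_k(\mathcal P_n)\subset\mathcal P_n$ for all $n\ge0$, $V_k(1)=1$ and $T_\xi V_k=V_k\partial_\xi$ for all $\xi\in V$; the series defining $C_n(g)$ converges absolutely for all $n\ge1$ and $g\in G$; and, for all $x,y\in V$ and all $n\ge1$, the degree-$n$ homogeneous part $$E_n(x,y)=\frac1{n!}\,V_k\bigl(\langle\cdot,y\rangle^n\bigr)(x)$$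 of the Dunkl kernel $E_k(x,y)=\sum_{n\ge0}E_n(x,y)$ is given by $$E_n(x,y)=\sum_{g_1,\dots,g_n\in G}C(g_1,\dots,g_n)\prod_{j=1}^n\langle g_jx,y\rangle .$$ -/

import Mathlib

open scoped InnerProductSpace Nat

/-- The orthogonal reflection in the hyperplane orthogonal to `α`. -/
noncomputable def rootReflection {V : Type*} [NormedAddCommGroup V] [InnerProductSpace ℝ V]
    (α : V) : V ≃ₗᵢ[ℝ] V :=
  (ℝ ∙ α)ᗮ.reflection

theorem rootReflection_apply {V : Type*} [NormedAddCommGroup V] [InnerProductSpace ℝ V]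
    (α x : V) : rootReflection α x = x - (2 * (⟪α, x⟫_ℝ / ⟪α, α⟫_ℝ)) • α := by
  rw [rootReflection, Submodule.reflection_orthogonal_apply, Submodule.reflection_singleton_apply,
    real_inner_self_eq_norm_sq]
  simp only [neg_sub, mul_smul, two_smul, RCLike.ofReal_real_eq_id, id_eq]

/-- A reduced (not necessarily crystallographic, not necessarily spanning) root system in a
Euclidean space. -/
structure EuclideanRootSystem (V : Type*) [NormedAddCommGroup V] [InnerProductSpace ℝ V] where
  roots : Finset V
  zero_notMem : (0 : V) ∉ roots
  image_reflection : ∀ α ∈ roots, rootReflection α '' (roots : Set V) = roots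
  reduced : ∀ α ∈ roots, (roots : Set V) ∩ {v | ∃ c : ℝ, v = c • α} = {α, -α}

section Polynomials

variable (V : Type*) [NormedAddCommGroup V] [InnerProductSpace ℝ V]

/-- The linear form `x ↦ ⟨x, y⟩`, with complex values. -/
noncomputable def linForm {V : Type*} [NormedAddCommGroup V] [InnerProductSpace ℝ V] (y : V) :
    V → ℂ :=
  fun x => ((⟪x, y⟫_ℝ : ℝ) : ℂ)

/-- The algebra of complex-valued polynomial functions on `V`. -/
noncomputable def polyFun : Subalgebra ℂ (V → ℂ) :=
  Algebra.adjoin ℂ (Set.range (linForm (V := V)))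

/-- The space of homogeneous polynomial functions of degree `n` on `V`. -/
def homogPoly (n : ℕ) : Set (polyFun V) :=
  {p | ∀ (t : ℝ) (x : V), (p : V → ℂ) (t • x) = (t : ℂ) ^ n * (p : V → ℂ) x}

variable {V}

/-- The directional derivative `∂_ξ f`. -/
noncomputable def dirDeriv (ξ : V) (f : V → ℂ) : V → ℂ :=
  fun x => fderiv ℝ f x ξ

theorem hasFDerivAt_linForm (y x : V) :
    HasFDerivAt (linForm y) (Complex.ofRealCLM.comp (innerSL ℝ y)) x := by
  have h : linForm y = fun x => (Complex.ofRealCLM.comp (innerSL ℝ y)) x := by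
    funext z
    simp [linForm, real_inner_comm]
  rw [h]
  exact (Complex.ofRealCLM.comp (innerSL ℝ y)).hasFDerivAt

theorem polyFun_deriv_aux (ξ : V) (f : V → ℂ) (hf : f ∈ polyFun V) :
    Differentiable ℝ f ∧ dirDeriv ξ f ∈ polyFun V := by
  refine Algebra.adjoin_induction
    (p := fun f _ => Differentiable ℝ f ∧ dirDeriv ξ f ∈ polyFun V) ?_ ?_ ?_ ?_ hf
  · rintro _ ⟨y, rfl⟩
    refine ⟨fun x => (hasFDerivAt_linForm y x).differentiableAt, ?_⟩
    have : dirDeriv ξ (linForm y) = algebraMap ℂ (V → ℂ) ((⟪y, ξ⟫_ℝ : ℝ) : ℂ) := by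
      funext x
      simp [dirDeriv, (hasFDerivAt_linForm y x).fderiv]
    rw [this]
    exact Subalgebra.algebraMap_mem _ _
  · intro r
    refine ⟨differentiable_const r, ?_⟩
    have : dirDeriv ξ (algebraMap ℂ (V → ℂ) r) = 0 := by
      funext x
      have h : (algebraMap ℂ (V → ℂ) r) = fun _ => r := rfl
      simp [dirDeriv, h]
    rw [this]
    exact Subalgebra.zero_mem _
  · rintro f g _ _ ⟨hf, hf'⟩ ⟨hg, hg'⟩
    refine ⟨hf.add hg, ?_⟩
    have : dirDeriv ξ (f + g) = dirDeriv ξ f + dirDeriv ξ g := by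
      funext x
      simp [dirDeriv, fderiv_add (hf x) (hg x)]
    rw [this]
    exact Subalgebra.add_mem _ hf' hg'
  · rintro f g hfm hgm ⟨hf, hf'⟩ ⟨hg, hg'⟩
    refine ⟨hf.mul hg, ?_⟩
    have : dirDeriv ξ (f * g) = f * dirDeriv ξ g + g * dirDeriv ξ f := by
      funext x
      simp [dirDeriv, fderiv_mul (hf x) (hg x)]
    rw [this]
    exact Subalgebra.add_mem _ (Subalgebra.mul_mem _ hfm hg') (Subalgebra.mul_mem _ hgm hf')

/-- The directional derivative as a map from polynomials to polynomials. -/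
noncomputable def polyDeriv (ξ : V) (p : polyFun V) : polyFun V :=
  ⟨dirDeriv ξ p, (polyFun_deriv_aux ξ p p.2).2⟩

/-- The polynomial `x ↦ ⟨x, y⟩`. -/
noncomputable def linPoly (y : V) : polyFun V :=
  ⟨linForm y, Algebra.subset_adjoin ⟨y, rfl⟩⟩

end Polynomials

namespace EuclideanRootSystem

variable {V : Type*} [NormedAddCommGroup V] [InnerProductSpace ℝ V]

/-- The reflection group of `R`, generated by the reflections in the roots. -/
def group (R : EuclideanRootSystem V) : Subgroup (V ≃ₗᵢ[ℝ] V) :=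
  Subgroup.closure (rootReflection '' (R.roots : Set V))

theorem group_apply_mem (R : EuclideanRootSystem V) {g : V ≃ₗᵢ[ℝ] V} (hg : g ∈ R.group) :
    g '' (R.roots : Set V) = R.roots := by
  refine Subgroup.closure_induction (k := rootReflection '' (R.roots : Set V))
    (p := fun g _ => g '' (R.roots : Set V) = R.roots) ?_ ?_ ?_ ?_ hg
  · rintro _ ⟨α, hα, rfl⟩
    exact R.image_reflection α hα
  · simp
  · intro a b _ _ ha hb
    rw [LinearIsometryEquiv.coe_mul, Set.image_comp, hb, ha]
  · intro a _ ha
    conv_lhs => rw [← ha]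
    rw [← Set.image_comp, ← LinearIsometryEquiv.coe_mul]
    simp

theorem group_apply_orthogonal (R : EuclideanRootSystem V) {g : V ≃ₗᵢ[ℝ] V} (hg : g ∈ R.group)
    {x : V} (hx : ∀ α ∈ R.roots, ⟪α, x⟫_ℝ = 0) : g x = x := by
  refine Subgroup.closure_induction (k := rootReflection '' (R.roots : Set V))
    (p := fun g _ => g x = x) ?_ ?_ ?_ ?_ hg
  · rintro _ ⟨α, hα, rfl⟩
    simp [rootReflection_apply, hx α hα]
  · simp
  · intro a b _ _ ha hb
    rw [LinearIsometryEquiv.coe_mul, Function.comp_apply, hb, ha]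
  · intro a _ ha
    conv_lhs => rw [← ha]
    exact a.symm_apply_apply x

instance finite_group (R : EuclideanRootSystem V) : Finite R.group := by
  let F : R.group → (R.roots → R.roots) := fun g α =>
    ⟨(g : V ≃ₗᵢ[ℝ] V) α, by
      have h := R.group_apply_mem g.2
      have : (g : V ≃ₗᵢ[ℝ] V) α ∈ (R.roots : Set V) := by
        rw [← h]
        exact ⟨α, α.2, rfl⟩
      exact this⟩
  refine Finite.of_injective F ?_
  intro g h hgh
  have hroot : ∀ α ∈ R.roots, (g : V ≃ₗᵢ[ℝ] V) α = (h : V ≃ₗᵢ[ℝ] V) α := fun α hα =>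
    congrArg Subtype.val (congrFun hgh ⟨α, hα⟩)
  let U : Submodule ℝ V := Submodule.span ℝ (R.roots : Set V)
  have hU : ∀ u ∈ U, (g : V ≃ₗᵢ[ℝ] V) u = (h : V ≃ₗᵢ[ℝ] V) u := by
    intro u hu
    induction hu using Submodule.span_induction with
    | mem x hx => exact hroot x hx
    | zero => simp
    | add x y _ _ hx hy => rw [map_add, map_add, hx, hy]
    | smul c x _ hx => rw [map_smul, map_smul, hx]
  have : FiniteDimensional ℝ U := FiniteDimensional.span_finset ℝ R.roots
  apply Subtype.ext
  ext x
  obtain ⟨u, hu, w, hw, rfl⟩ := U.exists_add_mem_mem_orthogonal x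
  have hw' : ∀ α ∈ R.roots, ⟪α, w⟫_ℝ = 0 := fun α hα =>
    (U.mem_orthogonal w).1 hw α (Submodule.subset_span hα)
  rw [map_add, map_add, hU u hu, R.group_apply_orthogonal g.2 hw',
    R.group_apply_orthogonal h.2 hw']

noncomputable instance fintype_group (R : EuclideanRootSystem V) : Fintype R.group :=
  Fintype.ofFinite _

/-- `k : R → ℂ` is a multiplicity function if it is invariant under the reflection group. -/
def IsMultiplicity (R : EuclideanRootSystem V) (k : R.roots → ℂ) : Prop :=
  ∀ g ∈ R.group, ∀ α α' : R.roots, g α = α' → k α' = k α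

open Classical in
/-- The positive system `R₊ = {α ∈ R : ⟨α, β⟩ > 0}`. -/
noncomputable def pos (R : EuclideanRootSystem V) (β : V) : Finset R.roots :=
  Finset.univ.filter fun α => 0 < ⟪(α : V), β⟫_ℝ

open Classical in
/-- The quotient `(f(x) - f(σ_α x)) / ⟨α, x⟩`, which for differentiable `f` extends to the
hyperplane `⟨α, x⟩ = 0` by the limit value `(2 / ⟨α, α⟩) ∂_α f(x)`. -/
noncomputable def diffQuot (α : V) (f : V → ℂ) (x : V) : ℂ :=
  if ⟪α, x⟫_ℝ = 0 then ((2 / ⟪α, α⟫_ℝ : ℝ) : ℂ) * dirDeriv α f x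
  else (f x - f (rootReflection α x)) / ((⟪α, x⟫_ℝ : ℝ) : ℂ)

/-- The Dunkl operator `T_ξ(k)`, with respect to the positive system given by `β`. -/
noncomputable def dunklOp (R : EuclideanRootSystem V) (β : V) (k : R.roots → ℂ) (ξ : V)
    (f : V → ℂ) : V → ℂ :=
  fun x => dirDeriv ξ f x +
    ∑ α ∈ R.pos β, k α * ((⟪(α : V), ξ⟫_ℝ : ℝ) : ℂ) * diffQuot (α : V) f x

/-- A linear automorphism of the space of polynomials that preserves each `𝒫ₙ`, fixes `1`, and
satisfies `T_ξ ∘ L = L ∘ ∂_ξ` for all `ξ`. -/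
structure IsIntertwining (R : EuclideanRootSystem V) (β : V) (k : R.roots → ℂ)
    (L : polyFun V ≃ₗ[ℂ] polyFun V) : Prop where
  map_homog : ∀ n : ℕ, ∀ p ∈ homogPoly V n, L p ∈ homogPoly V n
  map_one : L 1 = 1
  intertwines : ∀ (ξ : V) (p : polyFun V),
    R.dunklOp β k ξ (L p : V → ℂ) = (L (polyDeriv ξ p) : V → ℂ)

/-- The Dunkl intertwining operator `V_k`: the unique intertwining automorphism
(an arbitrary automorphism if there is none). -/
noncomputable def intertwiner (R : EuclideanRootSystem V) (β : V) (k : R.roots → ℂ) :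
    polyFun V ≃ₗ[ℂ] polyFun V :=
  haveI : Nonempty (polyFun V ≃ₗ[ℂ] polyFun V) := ⟨LinearEquiv.refl ℂ _⟩
  Classical.epsilon (R.IsIntertwining β k)

/-- The homogeneous part `Eₙ(x, y) = (1 / n!) V_k(⟨·, y⟩ⁿ)(x)` of degree `n` of the Dunkl kernel. -/
noncomputable def kernelPart (R : EuclideanRootSystem V) (β : V) (k : R.roots → ℂ) (n : ℕ)
    (x y : V) : ℂ :=
  (1 / (n ! : ℂ)) * (R.intertwiner β k (linPoly y ^ n) : V → ℂ) x

/-- `γ = ∑_{α ∈ R₊} k(α)`. -/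
noncomputable def gammaSum (R : EuclideanRootSystem V) (β : V) (k : R.roots → ℂ) : ℂ :=
  ∑ α ∈ R.pos β, k α

/-- `δ = ∑_{α ∈ R₊} |k(α)|`. -/
noncomputable def deltaSum (R : EuclideanRootSystem V) (β : V) (k : R.roots → ℂ) : ℝ :=
  ∑ α ∈ R.pos β, ‖k α‖

open Classical in
/-- `c_m(g)`: the sum of `k(α₁) ⋯ k(α_m)` over all `(α₁, …, α_m) ∈ R₊ᵐ` with
`σ_{α₁} ⋯ σ_{α_m} = g`. For `m = 0` this is `1` if `g = e` and `0` otherwise. -/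
noncomputable def cCoeff (R : EuclideanRootSystem V) (β : V) (k : R.roots → ℂ) (m : ℕ)
    (g : R.group) : ℂ :=
  ∑ a : Fin m → R.pos β,
    if (List.ofFn fun i => rootReflection ((a i : R.roots) : V)).prod = (g : V ≃ₗᵢ[ℝ] V)
    then ∏ i, k (a i) else 0

/-- The terms of the series defining `C_n(g)`. -/
noncomputable def cTerm (R : EuclideanRootSystem V) (β : V) (k : R.roots → ℂ) (n : ℕ)
    (g : R.group) (m : ℕ) : ℂ :=
  R.cCoeff β k m g / ((n : ℂ) + R.gammaSum β k) ^ (m + 1)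

/-- `C_n(g) = ∑_{m ≥ 0} c_m(g) / (n + γ)^{m+1}`. -/
noncomputable def bigC (R : EuclideanRootSystem V) (β : V) (k : R.roots → ℂ) (n : ℕ)
    (g : R.group) : ℂ :=
  ∑' m : ℕ, R.cTerm β k n g m

/-- `C(g₁, …, gₙ) = C_n(gₙ) C_{n-1}(gₙ⁻¹ g_{n-1}) ⋯ C₁(g₂⁻¹ g₁)`; the entry `g_{i+1}` of the
tuple is `g i` for `i = 0, …, n - 1`. -/
noncomputable def tupleC (R : EuclideanRootSystem V) (β : V) (k : R.roots → ℂ) {n : ℕ}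
    (g : Fin n → R.group) : ℂ :=
  ∏ i : Fin n,
    if h : (i : ℕ) + 1 < n then R.bigC β k ((i : ℕ) + 1) ((g ⟨(i : ℕ) + 1, h⟩)⁻¹ * g i)
    else R.bigC β k n (g i)

end EuclideanRootSystem

section PolynomialOperators

variable {V : Type*} [NormedAddCommGroup V] [InnerProductSpace ℝ V]

theorem polyFun.differentiable (p : polyFun V) : Differentiable ℝ (p : V → ℂ) :=
  (polyFun_deriv_aux (0 : V) p p.2).1

@[simp] theorem linPoly_apply (y x : V) : (linPoly y : V → ℂ) x = ((⟪x, y⟫_ℝ : ℝ) : ℂ) := rfl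

theorem polyFun.ext_apply {p q : polyFun V} (h : ∀ x, (p : V → ℂ) x = (q : V → ℂ) x) : p = q :=
  Subtype.ext (funext h)

theorem polyFun.coe_real_smul (c : ℝ) (p : polyFun V) : c • p = (c : ℂ) • p :=
  polyFun.ext_apply fun x => by simp

theorem isLinearMap_linPoly : IsLinearMap ℝ (linPoly : V → polyFun V) where
  map_add y z := polyFun.ext_apply fun x => by simp [inner_add_right]
  map_smul c y := polyFun.ext_apply fun x => by simp [real_inner_smul_right]

/-- Induction on polynomials, by multiplication with linear forms. -/
theorem polyFun.induction_linPoly {motive : polyFun V → Prop} (one : motive 1)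
    (add : ∀ p q, motive p → motive q → motive (p + q))
    (smul : ∀ (c : ℂ) p, motive p → motive (c • p))
    (mul : ∀ y p, motive p → motive (linPoly y * p)) (p : polyFun V) : motive p := by
  have zero : motive 0 := by simpa using smul 0 1 one
  have hp : (p : V → ℂ) ∈ Submodule.span ℂ
      (Submonoid.closure (Set.range (linForm (V := V))) : Set (V → ℂ)) := by
    rw [← Algebra.adjoin_eq_span]
    exact p.2
  suffices h : ∀ f ∈ Submodule.span ℂ
      (Submonoid.closure (Set.range (linForm (V := V))) : Set (V → ℂ)),
      ∃ q : polyFun V, (q : V → ℂ) = f ∧ motive q by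
    obtain ⟨q, hq, hm⟩ := h _ hp
    rwa [Subtype.ext hq] at hm
  intro f hf
  induction hf using Submodule.span_induction with
  | zero => exact ⟨0, rfl, zero⟩
  | add f g _ _ hf hg =>
    obtain ⟨p, rfl, hp⟩ := hf
    obtain ⟨q, rfl, hq⟩ := hg
    exact ⟨p + q, rfl, add _ _ hp hq⟩
  | smul c f _ hf =>
    obtain ⟨p, rfl, hp⟩ := hf
    exact ⟨c • p, rfl, smul _ _ hp⟩
  | mem f hf =>
    induction hf using Submonoid.closure_induction_left with
    | one => exact ⟨1, rfl, one⟩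
    | mul_left f hf g _ hg =>
      obtain ⟨y, rfl⟩ := hf
      obtain ⟨q, rfl, hq⟩ := hg
      exact ⟨linPoly y * q, rfl, mul _ _ hq⟩

/-- The directional derivative as a linear operator on polynomials. -/
noncomputable def polyDerivLin (ξ : V) : Module.End ℂ (polyFun V) where
  toFun := polyDeriv ξ
  map_add' p q := polyFun.ext_apply fun x => by
    simp [polyDeriv, dirDeriv,
      fderiv_add (polyFun.differentiable p x) (polyFun.differentiable q x)]
  map_smul' c p := polyFun.ext_apply fun x => by
    simp [polyDeriv, dirDeriv, fderiv_const_smul (polyFun.differentiable p x)]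

@[simp] theorem polyDerivLin_apply (ξ : V) (p : polyFun V) (x : V) :
    (polyDerivLin ξ p : V → ℂ) x = fderiv ℝ (p : V → ℂ) x ξ := rfl

theorem polyDerivLin_one (ξ : V) : polyDerivLin ξ 1 = 0 :=
  polyFun.ext_apply fun x => by
    simp

theorem polyDerivLin_linPoly_mul (ξ y : V) (p : polyFun V) :
    polyDerivLin ξ (linPoly y * p) =
      linPoly y * polyDerivLin ξ p + ((⟪ξ, y⟫_ℝ : ℝ) : ℂ) • p :=
  polyFun.ext_apply fun x => by
    have h := (hasFDerivAt_linForm y x).mul (polyFun.differentiable p x).hasFDerivAt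
    have h' : ((linPoly y * p : polyFun V) : V → ℂ) = linForm y * (p : V → ℂ) := rfl
    rw [polyDerivLin_apply, h', h.fderiv]
    simp [linForm, real_inner_comm]
    ring

theorem isLinearMap_polyDerivLin (p : polyFun V) :
    IsLinearMap ℝ fun ξ : V => polyDerivLin ξ p where
  map_add ξ η := polyFun.ext_apply fun x => by simp
  map_smul c ξ := polyFun.ext_apply fun x => by simp

theorem polyDerivLin_linPoly_pow (ξ y : V) (n : ℕ) :
    polyDerivLin ξ (linPoly y ^ (n + 1)) =
      (((n : ℂ) + 1) * ((⟪ξ, y⟫_ℝ : ℝ) : ℂ)) • linPoly y ^ n := by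
  induction n with
  | zero =>
    rw [pow_succ', polyDerivLin_linPoly_mul, pow_zero, polyDerivLin_one]
    simp
  | succ n ih =>
    rw [pow_succ', polyDerivLin_linPoly_mul, ih, mul_smul_comm, ← pow_succ', ← add_smul]
    push_cast
    ring_nf

/-- Composition with a linear isometry, as a linear operator on polynomials. -/
noncomputable def polyComp (g : V ≃ₗᵢ[ℝ] V) : Module.End ℂ (polyFun V) where
  toFun p := ⟨fun x => (p : V → ℂ) (g x), by
    refine Algebra.adjoin_induction
      (p := fun (f : V → ℂ) _ => (fun x => f (g x)) ∈ polyFun V) ?_ ?_ ?_ ?_ p.2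
    · rintro _ ⟨y, rfl⟩
      have h : (fun x => linForm y (g x)) = linForm (g.symm y) := by
        funext x
        simp only [linForm]
        rw [← g.inner_map_map x (g.symm y), g.apply_symm_apply]
      rw [h]
      exact Algebra.subset_adjoin ⟨_, rfl⟩
    · exact fun r => Subalgebra.algebraMap_mem _ r
    · exact fun f g _ _ hf hg => Subalgebra.add_mem _ hf hg
    · exact fun f g _ _ hf hg => Subalgebra.mul_mem _ hf hg⟩
  map_add' p q := rfl
  map_smul' c p := rfl

@[simp] theorem polyComp_apply (g : V ≃ₗᵢ[ℝ] V) (p : polyFun V) (x : V) :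
    (polyComp g p : V → ℂ) x = (p : V → ℂ) (g x) := rfl

theorem polyDerivLin_polyComp (g : V ≃ₗᵢ[ℝ] V) (ξ : V) (p : polyFun V) :
    polyDerivLin ξ (polyComp g p) = polyComp g (polyDerivLin (g ξ) p) :=
  polyFun.ext_apply fun x => by
    have h := (polyFun.differentiable p (g x)).hasFDerivAt.comp x
      (g.toContinuousLinearEquiv.toContinuousLinearMap.hasFDerivAt (x := x))
    have h' : ((polyComp g p : polyFun V) : V → ℂ) =
      (p : V → ℂ) ∘ g := rfl
    rw [polyDerivLin_apply, h', h.fderiv]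
    rfl

theorem rootReflection_of_inner_eq_zero {α x : V} (h : ⟪α, x⟫_ℝ = 0) : rootReflection α x = x := by
  simp [rootReflection_apply, h]

theorem rootReflection_mul_self (α : V) : rootReflection α * rootReflection α = 1 := by
  ext x
  exact ((ℝ ∙ α)ᗮ).reflection_reflection x

theorem rootReflection_map_mul (g : V ≃ₗᵢ[ℝ] V) (α : V) :
    rootReflection (g α) * g = g * rootReflection α := by
  ext x
  simp [rootReflection_apply]

theorem rootReflection_neg (α : V) : rootReflection (-α) = rootReflection α := by
  ext x
  simp [rootReflection_apply, neg_div]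

open EuclideanRootSystem in
theorem diffQuot_linForm (α y x : V) :
    diffQuot α (linForm y) x = ((2 * (⟪α, y⟫_ℝ / ⟪α, α⟫_ℝ) : ℝ) : ℂ) := by
  rw [diffQuot]
  split_ifs with h
  · simp [dirDeriv, (hasFDerivAt_linForm y x).fderiv, real_inner_comm]
    ring
  · rw [div_eq_iff (by exact_mod_cast h)]
    simp only [linForm, rootReflection_apply, inner_sub_left, real_inner_smul_left]
    push_cast
    ring

open EuclideanRootSystem in
theorem diffQuot_mul (α : V) {f g : V → ℂ} (hf : Differentiable ℝ f) (hg : Differentiable ℝ g)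
    (x : V) : diffQuot α (f * g) x =
      f x * diffQuot α g x + diffQuot α f x * g (rootReflection α x) := by
  simp only [diffQuot]
  split_ifs with h
  · rw [rootReflection_of_inner_eq_zero h]
    simp [dirDeriv, fderiv_mul (hf x) (hg x)]
    ring
  · simp only [Pi.mul_apply]
    ring

open EuclideanRootSystem in
theorem diffQuot_add (α : V) {f g : V → ℂ} (hf : Differentiable ℝ f) (hg : Differentiable ℝ g)
    (x : V) : diffQuot α (f + g) x = diffQuot α f x + diffQuot α g x := by
  simp only [diffQuot]
  split_ifs with h
  · simp [dirDeriv, fderiv_add (hf x) (hg x)]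
    ring
  · simp only [Pi.add_apply]
    ring

open EuclideanRootSystem in
theorem diffQuot_algebraMap (α : V) (c : ℂ) (x : V) :
    diffQuot α (algebraMap ℂ (V → ℂ) c) x = 0 := by
  have h : (algebraMap ℂ (V → ℂ) c) = fun _ => c := rfl
  simp [diffQuot, dirDeriv, h]

open EuclideanRootSystem in
theorem diffQuot_mem_polyFun (α : V) {f : V → ℂ} (hf : f ∈ polyFun V) :
    diffQuot α f ∈ polyFun V := by
  refine Algebra.adjoin_induction (p := fun f _ => diffQuot α f ∈ polyFun V) ?_ ?_ ?_ ?_ hf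
  · rintro _ ⟨y, rfl⟩
    rw [show diffQuot α (linForm y) = algebraMap ℂ (V → ℂ) _ from funext (diffQuot_linForm α y)]
    exact Subalgebra.algebraMap_mem _ _
  · intro c
    rw [show diffQuot α (algebraMap ℂ (V → ℂ) c) = 0 from funext (diffQuot_algebraMap α c)]
    exact Subalgebra.zero_mem _
  · intro f g hf hg hf' hg'
    rw [show diffQuot α (f + g) = diffQuot α f + diffQuot α g from
      funext (diffQuot_add α (polyFun.differentiable ⟨f, hf⟩) (polyFun.differentiable ⟨g, hg⟩))]
    exact Subalgebra.add_mem _ hf' hg'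
  · intro f g hf hg hf' hg'
    rw [show diffQuot α (f * g) = f * diffQuot α g +
        diffQuot α f * (polyComp (rootReflection α) ⟨g, hg⟩ : V → ℂ) from
      funext (diffQuot_mul α (polyFun.differentiable ⟨f, hf⟩) (polyFun.differentiable ⟨g, hg⟩))]
    exact Subalgebra.add_mem _ (Subalgebra.mul_mem _ hf hg')
      (Subalgebra.mul_mem _ hf' (polyComp (rootReflection α) ⟨g, hg⟩).2)

/-- The difference quotient `(p(x) - p(σ_α x)) / ⟨α, x⟩` as a linear operator on polynomials. -/
noncomputable def polyDiffQuot (α : V) : Module.End ℂ (polyFun V) where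
  toFun p := ⟨EuclideanRootSystem.diffQuot α p, diffQuot_mem_polyFun α p.2⟩
  map_add' p q := polyFun.ext_apply
    (diffQuot_add α (polyFun.differentiable p) (polyFun.differentiable q))
  map_smul' c p := polyFun.ext_apply fun x => by
    have h := diffQuot_mul α (differentiable_const (𝕜 := ℝ) (E := V) c) (polyFun.differentiable p) x
    have h' : (fun _ : V => c) = algebraMap ℂ (V → ℂ) c := rfl
    have h'' : ((c • p : polyFun V) : V → ℂ) = (fun _ => c) * (p : V → ℂ) := rfl
    change EuclideanRootSystem.diffQuot α ((c • p : polyFun V) : V → ℂ) x =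
      c * EuclideanRootSystem.diffQuot α p x
    rw [h'', h, h', diffQuot_algebraMap]
    simp

theorem polyDiffQuot_apply (α : V) (p : polyFun V) (x : V) :
    (polyDiffQuot α p : V → ℂ) x = EuclideanRootSystem.diffQuot α p x := rfl

theorem polyDiffQuot_one (α : V) : polyDiffQuot α 1 = 0 :=
  polyFun.ext_apply (diffQuot_algebraMap α 1)

theorem polyDiffQuot_linPoly_mul (α y : V) (p : polyFun V) :
    polyDiffQuot α (linPoly y * p) = linPoly y * polyDiffQuot α p +
      ((2 * (⟪α, y⟫_ℝ / ⟪α, α⟫_ℝ) : ℝ) : ℂ) • polyComp (rootReflection α) p :=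
  polyFun.ext_apply fun x => by
    have h := diffQuot_mul α (polyFun.differentiable (linPoly y)) (polyFun.differentiable p) x
    have h2 := diffQuot_linForm α y x
    change EuclideanRootSystem.diffQuot α (linPoly y : V → ℂ) x = _ at h2
    rw [h2] at h
    exact h

theorem linPoly_mul_polyDiffQuot (α : V) (p : polyFun V) :
    linPoly α * polyDiffQuot α p = p - polyComp (rootReflection α) p :=
  polyFun.ext_apply fun x => by
    simp only [MulMemClass.coe_mul, Pi.mul_apply, linPoly_apply, polyDiffQuot_apply,
      AddSubgroupClass.coe_sub, Pi.sub_apply, polyComp_apply, real_inner_comm α x,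
      EuclideanRootSystem.diffQuot]
    split_ifs with h
    · simp [h, rootReflection_of_inner_eq_zero h]
    · have : ((⟪α, x⟫_ℝ : ℝ) : ℂ) ≠ 0 := by exact_mod_cast h
      field_simp

theorem polyDiffQuot_neg (α : V) (p : polyFun V) : polyDiffQuot (-α) p = -polyDiffQuot α p :=
  polyFun.ext_apply fun x => by
    simp only [polyDiffQuot_apply, NegMemClass.coe_neg, Pi.neg_apply,
      EuclideanRootSystem.diffQuot, inner_neg_left, neg_eq_zero, inner_neg_right, neg_neg,
      rootReflection_neg, dirDeriv, map_neg]
    split_ifs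
    · ring
    · simp [div_neg]

theorem polyDiffQuot_polyComp (g : V ≃ₗᵢ[ℝ] V) (α : V) (p : polyFun V) :
    polyDiffQuot α (polyComp g p) = polyComp g (polyDiffQuot (g α) p) :=
  polyFun.ext_apply fun x => by
    have h1 := congrArg (fun q : polyFun V => (q : V → ℂ) x) (polyDerivLin_polyComp g α p)
    have h2 : rootReflection (g α) (g x) = g (rootReflection α x) :=
      congrArg (fun f : V ≃ₗᵢ[ℝ] V => f x) (rootReflection_map_mul g α)
    simp only [polyDerivLin_apply, polyComp_apply] at h1
    simp only [polyDiffQuot_apply, polyComp_apply, EuclideanRootSystem.diffQuot,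
      LinearIsometryEquiv.inner_map_map, h2, dirDeriv, h1]

/-- Homogeneous polynomials of degree `n`, as a submodule. -/
def homogSubmodule (V : Type*) [NormedAddCommGroup V] [InnerProductSpace ℝ V] (n : ℕ) :
    Submodule ℂ (polyFun V) where
  carrier := homogPoly V n
  zero_mem' := fun t x => by simp
  add_mem' := fun {p q} hp hq t x => by
    simp only [AddMemClass.coe_add, Pi.add_apply, hp t x, hq t x]
    ring
  smul_mem' := fun c p hp t x => by
    simp only [SetLike.val_smul, Pi.smul_apply, hp t x, smul_eq_mul]
    ring

theorem mem_homogSubmodule_of_ne_zero {n : ℕ} {p : polyFun V}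
    (h : ∀ t : ℝ, t ≠ 0 → ∀ x, (p : V → ℂ) (t • x) = (t : ℂ) ^ n * (p : V → ℂ) x) :
    p ∈ homogSubmodule V n := by
  intro t x
  have hp := (polyFun.differentiable p).continuous
  have h1 : Continuous fun t : ℝ => (p : V → ℂ) (t • x) := by fun_prop
  have h2 : Continuous fun t : ℝ => (t : ℂ) ^ n * (p : V → ℂ) x := by fun_prop
  exact congrFun (Continuous.ext_on (dense_compl_singleton (0 : ℝ)) h1 h2
    (fun t ht => h t ht x)) t

theorem linPoly_mul_mem {n : ℕ} (y : V) {p : polyFun V} (hp : p ∈ homogSubmodule V n) :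
    linPoly y * p ∈ homogSubmodule V (n + 1) := fun t x => by
  simp only [MulMemClass.coe_mul, Pi.mul_apply, linPoly_apply, real_inner_smul_left, hp t x]
  push_cast
  ring

theorem linPoly_pow_mem (y : V) (n : ℕ) : linPoly y ^ n ∈ homogSubmodule V n := fun t x => by
  simp [real_inner_smul_left, mul_pow]

theorem one_mem_homogSubmodule : (1 : polyFun V) ∈ homogSubmodule V 0 := fun t x => by simp

theorem polyComp_mem {n : ℕ} (g : V ≃ₗᵢ[ℝ] V) {p : polyFun V} (hp : p ∈ homogSubmodule V n) :
    polyComp g p ∈ homogSubmodule V n := fun t x => by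
  simp [hp t (g x)]

theorem eq_smul_one_of_mem_zero {p : polyFun V} (hp : p ∈ homogSubmodule V 0) :
    p = ((p : V → ℂ) 0) • (1 : polyFun V) :=
  polyFun.ext_apply fun x => by
    have := hp 0 x
    simp at this
    simp [this]

theorem fderiv_smul_of_mem {n : ℕ} {p : polyFun V} (hp : p ∈ homogSubmodule V n) (t : ℝ) (x ξ : V) :
    (t : ℂ) * fderiv ℝ (p : V → ℂ) (t • x) ξ = (t : ℂ) ^ n * fderiv ℝ (p : V → ℂ) x ξ := by
  have h1 : HasFDerivAt (fun z : V => (p : V → ℂ) (t • z))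
      ((fderiv ℝ (p : V → ℂ) (t • x)).comp (t • ContinuousLinearMap.id ℝ V)) x :=
    HasFDerivAt.comp x (polyFun.differentiable p (t • x)).hasFDerivAt
      ((hasFDerivAt_id x).const_smul t)
  have h2 : HasFDerivAt (fun z : V => (t : ℂ) ^ n * (p : V → ℂ) z)
      ((t : ℂ) ^ n • fderiv ℝ (p : V → ℂ) x) x :=
    (polyFun.differentiable p x).hasFDerivAt.const_mul _
  rw [show (fun z : V => (p : V → ℂ) (t • z)) = fun z : V => (t : ℂ) ^ n * (p : V → ℂ) z from
    funext fun z => hp t z] at h1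
  have := congrArg (fun l : V →L[ℝ] ℂ => l ξ) (h1.unique h2)
  simpa using this

theorem polyDerivLin_mem {n : ℕ} (ξ : V) {p : polyFun V} (hp : p ∈ homogSubmodule V (n + 1)) :
    polyDerivLin ξ p ∈ homogSubmodule V n :=
  mem_homogSubmodule_of_ne_zero fun t ht x => by
    have ht' : (t : ℂ) ≠ 0 := by exact_mod_cast ht
    apply mul_left_cancel₀ ht'
    rw [polyDerivLin_apply, polyDerivLin_apply, fderiv_smul_of_mem hp]
    ring

theorem polyDerivLin_of_mem_zero (ξ : V) {p : polyFun V} (hp : p ∈ homogSubmodule V 0) :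
    polyDerivLin ξ p = 0 := by
  rw [eq_smul_one_of_mem_zero hp, map_smul, polyDerivLin_one, smul_zero]

theorem polyDiffQuot_mem {n : ℕ} (α : V) {p : polyFun V} (hp : p ∈ homogSubmodule V (n + 1)) :
    polyDiffQuot α p ∈ homogSubmodule V n :=
  mem_homogSubmodule_of_ne_zero fun t ht x => by
    have ht' : (t : ℂ) ≠ 0 := by exact_mod_cast ht
    simp only [polyDiffQuot_apply, EuclideanRootSystem.diffQuot, real_inner_smul_right,
      mul_eq_zero, ht, false_or, map_smul, hp t _]
    split_ifs with h
    · have := polyDerivLin_mem α hp t x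
      simp only [polyDerivLin_apply] at this
      simp only [dirDeriv, this]
      ring
    · have : ((⟪α, x⟫_ℝ : ℝ) : ℂ) ≠ 0 := by exact_mod_cast h
      push_cast
      field_simp
      ring

theorem fderiv_apply_self_of_mem {n : ℕ} {p : polyFun V} (hp : p ∈ homogSubmodule V n) (x : V) :
    fderiv ℝ (p : V → ℂ) x x = n * (p : V → ℂ) x := by
  have h1 : HasDerivAt (fun t : ℝ => (p : V → ℂ) (t • x)) (fderiv ℝ (p : V → ℂ) x x) 1 := by
    have ha := (hasDerivAt_id (1 : ℝ)).smul_const x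
    have hb := (polyFun.differentiable p ((1 : ℝ) • x)).hasFDerivAt.comp_hasDerivAt (1 : ℝ) ha
    simpa [Function.comp_def] using hb
  have h2 : HasDerivAt (fun t : ℝ => (t : ℂ) ^ n * (p : V → ℂ) x) (n * (p : V → ℂ) x) 1 := by
    have := ((Complex.ofRealCLM.hasDerivAt (x := (1 : ℝ))).pow n).mul_const ((p : V → ℂ) x)
    simpa using this
  rw [show (fun t : ℝ => (p : V → ℂ) (t • x)) = fun t : ℝ => (t : ℂ) ^ n * (p : V → ℂ) x from
    funext fun t => hp t x] at h1
  exact h1.unique h2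

theorem iSup_homogSubmodule : ⨆ n, homogSubmodule V n = ⊤ := by
  refine eq_top_iff.2 fun p _ => ?_
  induction p using polyFun.induction_linPoly with
  | one => exact Submodule.mem_iSup_of_mem 0 one_mem_homogSubmodule
  | add p q hp hq => exact Submodule.add_mem _ (hp trivial) (hq trivial)
  | smul c p hp => exact Submodule.smul_mem _ c (hp trivial)
  | mul y p hp =>
    refine Submodule.iSup_induction _ (motive := fun p => linPoly y * p ∈ ⨆ n, homogSubmodule V n)
      (hp trivial) (fun n p hp => Submodule.mem_iSup_of_mem (n + 1) (linPoly_mul_mem y hp)) ?_ ?_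
    · simp
    · intro p q hp hq
      rw [mul_add]
      exact Submodule.add_mem _ hp hq

variable {ι : Type*} [Fintype ι]

theorem sum_linPoly_mul_polyDerivLin (b : OrthonormalBasis ι ℝ V) {n : ℕ} {p : polyFun V}
    (hp : p ∈ homogSubmodule V n) :
    ∑ i, linPoly (b i) * polyDerivLin (b i) p = (n : ℂ) • p :=
  polyFun.ext_apply fun x => by
    have h := fderiv_apply_self_of_mem hp x
    have h2 := congrArg (fderiv ℝ (p : V → ℂ) x) (b.sum_repr' x)
    rw [h, map_sum] at h2
    simpa [real_inner_comm] using h2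

theorem sum_inner_smul_of_isLinearMap (b : OrthonormalBasis ι ℝ V) {s : V → polyFun V}
    (hs : IsLinearMap ℝ s) (y : V) : ∑ i, ((⟪b i, y⟫_ℝ : ℝ) : ℂ) • s (b i) = s y := by
  conv_rhs => rw [← b.sum_repr' y]
  have := map_sum (hs.mk' s) (fun i => ⟪b i, y⟫_ℝ • b i) Finset.univ
  simp only [IsLinearMap.mk'_apply] at this
  rw [this]
  exact Finset.sum_congr rfl fun i _ => by rw [hs.map_smul, polyFun.coe_real_smul]

end PolynomialOperators

namespace EuclideanRootSystem

variable {V : Type*} [NormedAddCommGroup V] [InnerProductSpace ℝ V]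
  (R : EuclideanRootSystem V) (β : V) (k : R.roots → ℂ)

theorem apply_mem_roots (g : R.group) (α : R.roots) : (g : V ≃ₗᵢ[ℝ] V) α ∈ R.roots := by
  have h : (g : V ≃ₗᵢ[ℝ] V) α ∈ (R.roots : Set V) := by
    rw [← R.group_apply_mem g.2]
    exact ⟨α, α.2, rfl⟩
  exact h

/-- The permutation of the roots induced by an element of the reflection group. -/
def rootPerm (g : R.group) : Equiv.Perm R.roots where
  toFun α := ⟨(g : V ≃ₗᵢ[ℝ] V) α, R.apply_mem_roots g α⟩
  invFun α := ⟨((g⁻¹ : R.group) : V ≃ₗᵢ[ℝ] V) α, R.apply_mem_roots g⁻¹ α⟩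
  left_inv α := Subtype.ext ((g : V ≃ₗᵢ[ℝ] V).symm_apply_apply α)
  right_inv α := Subtype.ext ((g : V ≃ₗᵢ[ℝ] V).apply_symm_apply α)

@[simp] theorem coe_rootPerm (g : R.group) (α : R.roots) :
    (R.rootPerm g α : V) = (g : V ≃ₗᵢ[ℝ] V) α := rfl

/-- The reflection in a root, as an element of the reflection group. -/
noncomputable def refl (α : R.roots) : R.group :=
  ⟨rootReflection (α : V), Subgroup.subset_closure ⟨α, α.2, rfl⟩⟩

@[simp] theorem coe_refl (α : R.roots) :
    (R.refl α : V ≃ₗᵢ[ℝ] V) = rootReflection (α : V) := rfl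

theorem refl_mul_self (α : R.roots) : R.refl α * R.refl α = 1 :=
  Subtype.ext (rootReflection_mul_self _)

theorem refl_rootPerm_mul (g : R.group) (α : R.roots) :
    R.refl (R.rootPerm g α) * g = g * R.refl α :=
  Subtype.ext (rootReflection_map_mul _ _)

theorem coe_root_ne_zero (α : R.roots) : (α : V) ≠ 0 := fun h => R.zero_notMem (h ▸ α.2)

theorem inner_root_self_ne_zero (α : R.roots) : ⟪(α : V), (α : V)⟫_ℝ ≠ 0 :=
  inner_self_ne_zero.2 (R.coe_root_ne_zero α)

theorem rootReflection_self {α : V} (h : ⟪α, α⟫_ℝ ≠ 0) : rootReflection α α = -α := by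
  rw [rootReflection_apply, div_self h]
  module

/-- The negative of a root. -/
noncomputable def negRoot (α : R.roots) : R.roots := R.rootPerm (R.refl α) α

@[simp] theorem coe_negRoot (α : R.roots) : (R.negRoot α : V) = -α :=
  rootReflection_self (R.inner_root_self_ne_zero α)

theorem negRoot_negRoot (α : R.roots) : R.negRoot (R.negRoot α) = α :=
  Subtype.ext (by simp)

theorem rootPerm_negRoot (g : R.group) (α : R.roots) :
    R.rootPerm g (R.negRoot α) = R.negRoot (R.rootPerm g α) :=
  Subtype.ext (by simp)

theorem refl_negRoot (α : R.roots) : R.refl (R.negRoot α) = R.refl α :=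
  Subtype.ext (by simp [rootReflection_neg])

variable {R k} in
theorem IsMultiplicity.rootPerm (hk : R.IsMultiplicity k) (g : R.group) (α : R.roots) :
    k (R.rootPerm g α) = k α :=
  hk g g.2 α _ rfl

variable {R k} in
theorem IsMultiplicity.negRoot (hk : R.IsMultiplicity k) (α : R.roots) :
    k (R.negRoot α) = k α :=
  hk.rootPerm _ _

@[simp] theorem mem_pos {α : R.roots} : α ∈ R.pos β ↔ 0 < ⟪(α : V), β⟫_ℝ := by
  simp [pos]

section SumPos

variable {β} {M : Type*} [AddCommGroup M] [Module ℂ M]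

theorem two_smul_sum_pos (hβ : ∀ α ∈ R.roots, ⟪α, β⟫_ℝ ≠ 0) (F : R.roots → M)
    (hF : ∀ α, F (R.negRoot α) = F α) : (2 : ℂ) • ∑ α ∈ R.pos β, F α = ∑ α, F α := by
  classical
  rw [← Finset.sum_filter_add_sum_filter_not Finset.univ (fun α => α ∈ R.pos β), two_smul]
  congr 1
  · exact Finset.sum_congr (by ext; simp) fun _ _ => rfl
  · refine Finset.sum_nbij' R.negRoot R.negRoot ?_ ?_ ?_ ?_ ?_
    · intro α hα
      have := (R.mem_pos β).1 hα
      simp [this.le]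
    · intro α hα
      have h1 := hβ α α.2
      simp only [mem_pos, not_lt, Finset.mem_filter, Finset.mem_univ, true_and] at hα
      simpa using lt_of_le_of_ne hα h1
    · exact fun α _ => R.negRoot_negRoot α
    · exact fun α _ => R.negRoot_negRoot α
    · exact fun α _ => (hF α).symm

/-- Sums of even functions over the positive roots are invariant under the reflection group. -/
theorem sum_pos_rootPerm (hβ : ∀ α ∈ R.roots, ⟪α, β⟫_ℝ ≠ 0) (F : R.roots → M)
    (hF : ∀ α, F (R.negRoot α) = F α) (g : R.group) :
    ∑ α ∈ R.pos β, F (R.rootPerm g α) = ∑ α ∈ R.pos β, F α := by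
  have h1 := R.two_smul_sum_pos hβ F hF
  have h2 := R.two_smul_sum_pos hβ (fun α => F (R.rootPerm g α))
    (fun α => by rw [rootPerm_negRoot, hF])
  rw [Equiv.sum_comp (R.rootPerm g) F, ← h1] at h2
  exact smul_right_injective M (two_ne_zero : (2 : ℂ) ≠ 0) h2

end SumPos

section Coefficients

theorem cCoeff_zero (g : R.group) [Decidable (g = 1)] :
    R.cCoeff β k 0 g = if g = 1 then 1 else 0 := by
  have h : (1 : V ≃ₗᵢ[ℝ] V) = (g : V ≃ₗᵢ[ℝ] V) ↔ g = 1 := by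
    rw [eq_comm, OneMemClass.coe_eq_one]
  simp only [cCoeff, Fintype.sum_unique, List.ofFn_zero, List.prod_nil, h,
    Finset.univ_eq_empty, Finset.prod_empty]

theorem cCoeff_succ (m : ℕ) (g : R.group) :
    R.cCoeff β k (m + 1) g = ∑ α ∈ R.pos β, k α * R.cCoeff β k m (R.refl α * g) := by
  classical
  have h (α : R.roots) (w : V ≃ₗᵢ[ℝ] V) : rootReflection (α : V) * w = (g : V ≃ₗᵢ[ℝ] V) ↔
      w = ((R.refl α * g : R.group) : V ≃ₗᵢ[ℝ] V) := by
    rw [Subgroup.coe_mul, coe_refl]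
    constructor
    · rintro h
      rw [← h, ← mul_assoc, rootReflection_mul_self, one_mul]
    · rintro rfl
      rw [← mul_assoc, rootReflection_mul_self, one_mul]
  rw [cCoeff, ← (Fin.consEquiv fun _ : Fin (m + 1) => (R.pos β : Type _)).sum_comp,
    Fintype.sum_prod_type, ← Finset.sum_coe_sort (R.pos β) fun α => k α * R.cCoeff β k m (R.refl α * g)]
  refine Fintype.sum_congr _ _ fun α => ?_
  rw [cCoeff, Finset.mul_sum]
  refine Finset.sum_congr rfl fun a _ => ?_
  simp only [Fin.consEquiv_apply, List.ofFn_succ, Fin.cons_zero, Fin.cons_succ, List.prod_cons,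
    Fin.prod_univ_succ, h, mul_ite, mul_zero]

theorem norm_cCoeff_le (m : ℕ) (g : R.group) : ‖R.cCoeff β k m g‖ ≤ R.deltaSum β k ^ m := by
  classical
  induction m generalizing g with
  | zero =>
    rw [cCoeff_zero]
    split_ifs <;> simp
  | succ m ih =>
    rw [cCoeff_succ, pow_succ', deltaSum, Finset.sum_mul]
    refine (norm_sum_le _ _).trans (Finset.sum_le_sum fun α _ => ?_)
    rw [norm_mul]
    exact mul_le_mul_of_nonneg_left (ih _) (norm_nonneg _)

variable {R β k}

theorem cCoeff_conj (hβ : ∀ α ∈ R.roots, ⟪α, β⟫_ℝ ≠ 0) (hk : R.IsMultiplicity k) (m : ℕ)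
    (h g : R.group) : R.cCoeff β k m (h * g * h⁻¹) = R.cCoeff β k m g := by
  classical
  induction m generalizing g with
  | zero => simp only [cCoeff_zero, conj_eq_one_iff]
  | succ m ih =>
    rw [cCoeff_succ, cCoeff_succ, ← R.sum_pos_rootPerm hβ _ _ h]
    · refine Finset.sum_congr rfl fun α _ => ?_
      rw [hk.rootPerm, ← mul_assoc, ← mul_assoc, refl_rootPerm_mul, mul_assoc h, ih]
    · intro α
      rw [hk.negRoot, refl_negRoot]

theorem deltaSum_nonneg : 0 ≤ R.deltaSum β k := Finset.sum_nonneg fun _ _ => norm_nonneg _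

theorem deltaSum_lt_norm (hδ : R.deltaSum β k < ‖1 + R.gammaSum β k‖) {n : ℕ} (hn : 1 ≤ n) :
    R.deltaSum β k < ‖(n : ℂ) + R.gammaSum β k‖ := by
  have h1 : ‖R.gammaSum β k‖ ≤ R.deltaSum β k := norm_sum_le _ _
  refine hδ.trans_le ?_
  have h2 := h1.trans_lt hδ
  generalize R.gammaSum β k = z at h2
  have hn' : (1 : ℝ) ≤ n := by exact_mod_cast hn
  have h3 : ‖z‖ ^ 2 < ‖1 + z‖ ^ 2 := by gcongr
  refine le_of_sq_le_sq ?_ (norm_nonneg _)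
  simp only [Complex.sq_norm, Complex.normSq_apply, Complex.add_re, Complex.add_im, Complex.one_re,
    Complex.one_im, Complex.natCast_re, Complex.natCast_im] at h3 ⊢
  nlinarith

theorem norm_cTerm_le (hδ : R.deltaSum β k < ‖1 + R.gammaSum β k‖) {n : ℕ} (hn : 1 ≤ n)
    (g : R.group) (m : ℕ) : ‖R.cTerm β k n g m‖ ≤
      ‖(n : ℂ) + R.gammaSum β k‖⁻¹ * (R.deltaSum β k / ‖(n : ℂ) + R.gammaSum β k‖) ^ m := by
  have h := R.norm_cCoeff_le β k m g
  have h0 := deltaSum_nonneg.trans_lt (deltaSum_lt_norm hδ hn)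
  rw [cTerm, norm_div, norm_pow, div_pow, pow_succ, div_le_iff₀ (by positivity)]
  refine h.trans_eq ?_
  field_simp

theorem summable_cTerm (hδ : R.deltaSum β k < ‖1 + R.gammaSum β k‖) {n : ℕ} (hn : 1 ≤ n)
    (g : R.group) : Summable (R.cTerm β k n g) := by
  have h := deltaSum_lt_norm hδ hn
  have h0 := (deltaSum_nonneg (k := k)).trans_lt h
  refine Summable.of_norm_bounded ?_ (norm_cTerm_le hδ hn g)
  exact (summable_geometric_of_lt_one (div_nonneg deltaSum_nonneg h0.le)
    ((div_lt_one h0).2 h)).mul_left _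

theorem bigC_conj (hβ : ∀ α ∈ R.roots, ⟪α, β⟫_ℝ ≠ 0) (hk : R.IsMultiplicity k) (n : ℕ)
    (h g : R.group) : R.bigC β k n (h * g * h⁻¹) = R.bigC β k n g := by
  simp only [bigC, cTerm, cCoeff_conj hβ hk]

theorem gamma_ne_zero (hδ : R.deltaSum β k < ‖1 + R.gammaSum β k‖) {n : ℕ} (hn : 1 ≤ n) :
    (n : ℂ) + R.gammaSum β k ≠ 0 :=
  norm_pos_iff.1 (deltaSum_nonneg.trans_lt (deltaSum_lt_norm hδ hn))

/-- In the group algebra, `∑ C_n(g) g` is inverse to `n + γ - ∑ k(α) σ_α`. -/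
theorem mul_bigC (hδ : R.deltaSum β k < ‖1 + R.gammaSum β k‖) {n : ℕ} (hn : 1 ≤ n)
    (g : R.group) [Decidable (g = 1)] : ((n : ℂ) + R.gammaSum β k) * R.bigC β k n g =
      (if g = 1 then 1 else 0) + ∑ α ∈ R.pos β, k α * R.bigC β k n (R.refl α * g) := by
  have hne := gamma_ne_zero hδ hn
  have h1 (m : ℕ) : R.cTerm β k n g (m + 1) = ((n : ℂ) + R.gammaSum β k)⁻¹ *
      ∑ α ∈ R.pos β, k α * R.cTerm β k n (R.refl α * g) m := by
    simp only [cTerm, cCoeff_succ, Finset.sum_div, Finset.mul_sum]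
    refine Finset.sum_congr rfl fun α _ => ?_
    field_simp
    ring
  have h2 (α : R.roots) : Summable fun m => k α * R.cTerm β k n (R.refl α * g) m :=
    (summable_cTerm hδ hn _).mul_left _
  rw [bigC, (summable_cTerm hδ hn g).tsum_eq_zero_add]
  simp only [h1]
  rw [tsum_mul_left, Summable.tsum_finsetSum fun α _ => h2 α]
  simp only [tsum_mul_left]
  rw [mul_add, mul_inv_cancel_left₀ hne, cTerm, cCoeff_zero, zero_add, pow_one,
    mul_div_cancel₀ _ hne]
  rfl

theorem mul_bigC_right (hβ : ∀ α ∈ R.roots, ⟪α, β⟫_ℝ ≠ 0) (hk : R.IsMultiplicity k)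
    (hδ : R.deltaSum β k < ‖1 + R.gammaSum β k‖) {n : ℕ} (hn : 1 ≤ n)
    (g : R.group) [Decidable (g = 1)] : ((n : ℂ) + R.gammaSum β k) * R.bigC β k n g =
      (if g = 1 then 1 else 0) + ∑ α ∈ R.pos β, k α * R.bigC β k n (g * R.refl α) := by
  rw [mul_bigC hδ hn]
  congr 1
  refine Finset.sum_congr rfl fun α _ => ?_
  rw [← bigC_conj hβ hk n (R.refl α) (g * R.refl α)]
  congr 2
  rw [← mul_assoc, mul_assoc, mul_inv_cancel, mul_one]

end Coefficients

section Resolvent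

variable {R β k} {M : Type*} [AddCommGroup M] [Module ℂ M]

/-- The operator `∑ C_n(g) ρ(g)`. -/
noncomputable def resolvent (R : EuclideanRootSystem V) (β : V) (k : R.roots → ℂ) (n : ℕ)
    (ρ : R.group → Module.End ℂ M) : Module.End ℂ M :=
  ∑ g, R.bigC β k n g • ρ g

theorem resolvent_apply (n : ℕ) (ρ : R.group → Module.End ℂ M) (v : M) :
    R.resolvent β k n ρ v = ∑ g, R.bigC β k n g • ρ g v := by
  simp [resolvent, LinearMap.sum_apply]

/-- For an anti-representation `ρ`, the operator `∑ C_n(g) ρ(g)` is a left inverse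
of `n + γ - ∑ k(α) ρ(σ_α)`. -/
theorem resolvent_sub (hδ : R.deltaSum β k < ‖1 + R.gammaSum β k‖) {n : ℕ} (hn : 1 ≤ n)
    (ρ : R.group → Module.End ℂ M) (ρ_one : ρ 1 = 1)
    (ρ_mul : ∀ g h v, ρ g (ρ h v) = ρ (h * g) v) (v : M) :
    R.resolvent β k n ρ (((n : ℂ) + R.gammaSum β k) • v -
      ∑ α ∈ R.pos β, k α • ρ (R.refl α) v) = v := by
  classical
  have h1 (α : R.roots) : ∑ g, R.bigC β k n g • ρ (R.refl α * g) v =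
      ∑ g, R.bigC β k n (R.refl α * g) • ρ g v := by
    rw [← Equiv.sum_comp (Equiv.mulLeft (R.refl α))]
    refine Finset.sum_congr rfl fun g _ => ?_
    rw [Equiv.coe_mulLeft, ← mul_assoc, refl_mul_self, one_mul]
  have h2 : ∑ g, (((n : ℂ) + R.gammaSum β k) * R.bigC β k n g) • ρ g v =
      v + ∑ α ∈ R.pos β, k α • ∑ g, R.bigC β k n (R.refl α * g) • ρ g v := by
    simp only [mul_bigC hδ hn, add_smul, Finset.sum_add_distrib, ite_smul, one_smul, zero_smul,
      Finset.sum_ite_eq', Finset.mem_univ, if_true, ρ_one, Module.End.one_apply, Finset.sum_smul,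
      Finset.smul_sum, mul_smul]
    rw [Finset.sum_comm]
  rw [map_sub, map_smul, map_sum]
  simp only [map_smul, resolvent_apply, ρ_mul, h1]
  rw [Finset.smul_sum]
  simp only [← mul_smul _ _ (ρ _ v)]
  rw [h2, add_sub_cancel_right]

/-- For an anti-representation `ρ`, the operator `∑ C_n(g) ρ(g)` is a right inverse
of `n + γ - ∑ k(α) ρ(σ_α)`. -/
theorem sub_resolvent (hβ : ∀ α ∈ R.roots, ⟪α, β⟫_ℝ ≠ 0) (hk : R.IsMultiplicity k)
    (hδ : R.deltaSum β k < ‖1 + R.gammaSum β k‖) {n : ℕ} (hn : 1 ≤ n)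
    (ρ : R.group → Module.End ℂ M) (ρ_one : ρ 1 = 1)
    (ρ_mul : ∀ g h v, ρ g (ρ h v) = ρ (h * g) v) (v : M) :
    ((n : ℂ) + R.gammaSum β k) • R.resolvent β k n ρ v -
      ∑ α ∈ R.pos β, k α • ρ (R.refl α) (R.resolvent β k n ρ v) = v := by
  classical
  have h1 (α : R.roots) : ∑ g, R.bigC β k n g • ρ (g * R.refl α) v =
      ∑ g, R.bigC β k n (g * R.refl α) • ρ g v := by
    rw [← Equiv.sum_comp (Equiv.mulRight (R.refl α))]
    refine Finset.sum_congr rfl fun g _ => ?_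
    rw [Equiv.coe_mulRight, mul_assoc, refl_mul_self, mul_one]
  have h2 : ∑ g, (((n : ℂ) + R.gammaSum β k) * R.bigC β k n g) • ρ g v =
      v + ∑ α ∈ R.pos β, k α • ∑ g, R.bigC β k n (g * R.refl α) • ρ g v := by
    simp only [mul_bigC_right hβ hk hδ hn, add_smul, Finset.sum_add_distrib, ite_smul, one_smul,
      zero_smul, Finset.sum_ite_eq', Finset.mem_univ, if_true, ρ_one, Module.End.one_apply,
      Finset.sum_smul, Finset.smul_sum, mul_smul]
    rw [Finset.sum_comm]
  simp only [resolvent_apply, map_sum, map_smul, ρ_mul, h1]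
  rw [Finset.smul_sum]
  simp only [← mul_smul _ _ (ρ _ v)]
  rw [h2, add_sub_cancel_right]

end Resolvent

end EuclideanRootSystem

namespace EuclideanRootSystem

variable {V : Type*} [NormedAddCommGroup V] [InnerProductSpace ℝ V]

/-- The Dunkl operator as a linear operator on polynomials. -/
noncomputable def polyDunkl (R : EuclideanRootSystem V) (β : V) (k : R.roots → ℂ) (ξ : V) :
    Module.End ℂ (polyFun V) :=
  polyDerivLin ξ + ∑ α ∈ R.pos β, (k α * ((⟪(α : V), ξ⟫_ℝ : ℝ) : ℂ)) • polyDiffQuot (α : V)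

variable {R : EuclideanRootSystem V} {β : V} {k : R.roots → ℂ}

theorem polyDunkl_apply (ξ : V) (p : polyFun V) : R.polyDunkl β k ξ p = polyDerivLin ξ p +
    ∑ α ∈ R.pos β, (k α * ((⟪(α : V), ξ⟫_ℝ : ℝ) : ℂ)) • polyDiffQuot (α : V) p := by
  simp [polyDunkl, LinearMap.sum_apply]

theorem coe_polyDunkl (ξ : V) (p : polyFun V) :
    (R.polyDunkl β k ξ p : V → ℂ) = R.dunklOp β k ξ p := by
  funext x
  rw [polyDunkl_apply]
  simp [dunklOp, dirDeriv, polyDiffQuot_apply]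

theorem isLinearMap_polyDunkl (p : polyFun V) : IsLinearMap ℝ fun ξ => R.polyDunkl β k ξ p where
  map_add ξ η := by
    simp only [polyDunkl_apply, (isLinearMap_polyDerivLin p).map_add, inner_add_right,
      Complex.ofReal_add, mul_add, add_smul, Finset.sum_add_distrib]
    abel
  map_smul c ξ := by
    simp only [polyDunkl_apply, (isLinearMap_polyDerivLin p).map_smul, real_inner_smul_right,
      polyFun.coe_real_smul, Complex.ofReal_mul, smul_add, Finset.smul_sum, smul_smul]
    congr 1
    refine Finset.sum_congr rfl fun α _ => ?_
    congr 1
    ring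

theorem polyDunkl_one (ξ : V) : R.polyDunkl β k ξ 1 = 0 := by
  simp [polyDunkl_apply, polyDerivLin_one, polyDiffQuot_one]

theorem polyDunkl_linPoly_mul (ξ y : V) (p : polyFun V) :
    R.polyDunkl β k ξ (linPoly y * p) = linPoly y * R.polyDunkl β k ξ p +
      ((⟪ξ, y⟫_ℝ : ℝ) : ℂ) • p + ∑ α ∈ R.pos β, (k α * ((⟪(α : V), ξ⟫_ℝ : ℝ) : ℂ) *
        ((2 * (⟪(α : V), y⟫_ℝ / ⟪(α : V), α⟫_ℝ) : ℝ) : ℂ)) •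
          polyComp (rootReflection (α : V)) p := by
  simp only [polyDunkl_apply, polyDerivLin_linPoly_mul, polyDiffQuot_linPoly_mul, mul_add,
    smul_add, Finset.sum_add_distrib, Finset.mul_sum, mul_smul_comm, smul_smul]
  abel

theorem polyDunkl_polyComp (hβ : ∀ α ∈ R.roots, ⟪α, β⟫_ℝ ≠ 0) (hk : R.IsMultiplicity k)
    (g : R.group) (ξ : V) (p : polyFun V) :
    R.polyDunkl β k ξ (polyComp g p) =
      polyComp g (R.polyDunkl β k ((g : V ≃ₗᵢ[ℝ] V) ξ) p) := by
  have h := R.sum_pos_rootPerm hβ (fun α => (k α * ((⟪(α : V), (g : V ≃ₗᵢ[ℝ] V) ξ⟫_ℝ : ℝ) : ℂ)) •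
    polyComp (g : V ≃ₗᵢ[ℝ] V) (polyDiffQuot (α : V) p)) (fun α => by
      simp only [hk.negRoot, coe_negRoot, polyDiffQuot_neg, inner_neg_left, Complex.ofReal_neg,
        mul_neg, neg_smul, smul_neg, neg_neg, map_neg]) g
  simp only [hk.rootPerm, coe_rootPerm, LinearIsometryEquiv.inner_map_map] at h
  rw [polyDunkl_apply, polyDunkl_apply, polyDerivLin_polyComp, map_add, map_sum]
  simp only [map_smul, polyDiffQuot_polyComp, h]

theorem polyDunkl_mem {n : ℕ} (ξ : V) {p : polyFun V} (hp : p ∈ homogSubmodule V (n + 1)) :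
    R.polyDunkl β k ξ p ∈ homogSubmodule V n := by
  rw [polyDunkl_apply]
  exact Submodule.add_mem _ (polyDerivLin_mem ξ hp)
    (Submodule.sum_mem _ fun α _ => Submodule.smul_mem _ _ (polyDiffQuot_mem _ hp))

theorem polyDunkl_of_mem_zero (ξ : V) {p : polyFun V} (hp : p ∈ homogSubmodule V 0) :
    R.polyDunkl β k ξ p = 0 := by
  rw [eq_smul_one_of_mem_zero hp, map_smul, polyDunkl_one, smul_zero]

theorem map_rootReflection_of_isLinearMap {s : V → polyFun V} (hs : IsLinearMap ℝ s) (α ξ : V) :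
    s (rootReflection α ξ) = s ξ - ((2 * (⟪α, ξ⟫_ℝ / ⟪α, α⟫_ℝ) : ℝ) : ℂ) • s α := by
  rw [rootReflection_apply, hs.map_sub, hs.map_smul, polyFun.coe_real_smul]

theorem polyDunkl_rootReflection (hβ : ∀ α ∈ R.roots, ⟪α, β⟫_ℝ ≠ 0) (hk : R.IsMultiplicity k)
    (α : R.roots) (ξ : V) (p : polyFun V) :
    R.polyDunkl β k ξ (polyComp (rootReflection (α : V)) p) =
      polyComp (rootReflection (α : V)) (R.polyDunkl β k ξ p) -
        ((2 * (⟪(α : V), ξ⟫_ℝ / ⟪(α : V), α⟫_ℝ) : ℝ) : ℂ) •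
          polyComp (rootReflection (α : V)) (R.polyDunkl β k α p) := by
  have h := polyDunkl_polyComp hβ hk (R.refl α) ξ p
  rw [coe_refl] at h
  rw [h, map_rootReflection_of_isLinearMap (isLinearMap_polyDunkl p), map_sub, map_smul]

/-- Dunkl operators commute. -/
theorem polyDunkl_comm (hβ : ∀ α ∈ R.roots, ⟪α, β⟫_ℝ ≠ 0) (hk : R.IsMultiplicity k)
    (ξ η : V) (p : polyFun V) :
    R.polyDunkl β k ξ (R.polyDunkl β k η p) = R.polyDunkl β k η (R.polyDunkl β k ξ p) := by
  induction p using polyFun.induction_linPoly with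
  | one => simp only [polyDunkl_one, map_zero]
  | add p q hp hq => simp only [map_add, hp, hq]
  | smul c p hp => simp only [map_smul, hp]
  | mul y p hp =>
    have key (ξ η : V) : R.polyDunkl β k ξ (R.polyDunkl β k η (linPoly y * p)) =
        linPoly y * R.polyDunkl β k ξ (R.polyDunkl β k η p) +
        (((⟪ξ, y⟫_ℝ : ℝ) : ℂ) • R.polyDunkl β k η p +
          ((⟪η, y⟫_ℝ : ℝ) : ℂ) • R.polyDunkl β k ξ p) +
        (∑ α ∈ R.pos β, (k α * ((⟪(α : V), ξ⟫_ℝ : ℝ) : ℂ) *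
            ((2 * (⟪(α : V), y⟫_ℝ / ⟪(α : V), α⟫_ℝ) : ℝ) : ℂ)) •
            polyComp (rootReflection (α : V)) (R.polyDunkl β k η p) +
          ∑ α ∈ R.pos β, (k α * ((⟪(α : V), η⟫_ℝ : ℝ) : ℂ) *
            ((2 * (⟪(α : V), y⟫_ℝ / ⟪(α : V), α⟫_ℝ) : ℝ) : ℂ)) •
            polyComp (rootReflection (α : V)) (R.polyDunkl β k ξ p)) -
        ∑ α ∈ R.pos β, (k α * ((⟪(α : V), ξ⟫_ℝ : ℝ) : ℂ) * ((⟪(α : V), η⟫_ℝ : ℝ) : ℂ) *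
            ((2 / ⟪(α : V), α⟫_ℝ * (2 * (⟪(α : V), y⟫_ℝ / ⟪(α : V), α⟫_ℝ)) : ℝ) : ℂ)) •
            polyComp (rootReflection (α : V)) (R.polyDunkl β k α p) := by
      rw [polyDunkl_linPoly_mul, map_add, map_add, polyDunkl_linPoly_mul, map_smul, map_sum]
      simp only [map_smul, polyDunkl_rootReflection hβ hk, smul_sub, Finset.sum_sub_distrib,
        smul_smul]
      have : ∀ α : R.roots, k α * ((⟪(α : V), η⟫_ℝ : ℝ) : ℂ) *
          ((2 * (⟪(α : V), y⟫_ℝ / ⟪(α : V), α⟫_ℝ) : ℝ) : ℂ) *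
          ((2 * (⟪(α : V), ξ⟫_ℝ / ⟪(α : V), α⟫_ℝ) : ℝ) : ℂ) =
          k α * ((⟪(α : V), ξ⟫_ℝ : ℝ) : ℂ) * ((⟪(α : V), η⟫_ℝ : ℝ) : ℂ) *
            ((2 / ⟪(α : V), α⟫_ℝ * (2 * (⟪(α : V), y⟫_ℝ / ⟪(α : V), α⟫_ℝ)) : ℝ) : ℂ) := by
        intro α
        push_cast
        ring
      simp only [this]
      abel
    rw [key ξ η, key η ξ, hp]
    congr 1
    · rw [add_comm (_ • R.polyDunkl β k η p),
        add_comm (∑ α ∈ R.pos β, _ • polyComp _ (R.polyDunkl β k η p))]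
    · refine Finset.sum_congr rfl fun α _ => ?_
      rw [mul_right_comm (k α)]

theorem polyDerivLin_comm (ξ η : V) (p : polyFun V) :
    polyDerivLin ξ (polyDerivLin η p) = polyDerivLin η (polyDerivLin ξ p) := by
  induction p using polyFun.induction_linPoly with
  | one => simp only [polyDerivLin_one, map_zero]
  | add p q hp hq => simp only [map_add, hp, hq]
  | smul c p hp => simp only [map_smul, hp]
  | mul y p hp =>
    simp only [polyDerivLin_linPoly_mul, map_add, map_smul, hp]
    abel

section Euler

variable {ι : Type*} [Fintype ι] (b : OrthonormalBasis ι ℝ V)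

/-- The Dunkl analogue of Euler's identity. -/
theorem sum_linPoly_mul_polyDunkl {n : ℕ} {p : polyFun V} (hp : p ∈ homogSubmodule V n) :
    ∑ i, linPoly (b i) * R.polyDunkl β k (b i) p = ((n : ℂ) + R.gammaSum β k) • p -
      ∑ α ∈ R.pos β, k α • polyComp (rootReflection (α : V)) p := by
  have h (α : R.roots) : ∑ i, linPoly (b i) *
      ((k α * ((⟪(α : V), b i⟫_ℝ : ℝ) : ℂ)) • polyDiffQuot (α : V) p) =
      k α • p - k α • polyComp (rootReflection (α : V)) p := by
    rw [← smul_sub, ← linPoly_mul_polyDiffQuot,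
      ← sum_inner_smul_of_isLinearMap b isLinearMap_linPoly (α : V), Finset.sum_mul,
      Finset.smul_sum]
    refine Finset.sum_congr rfl fun i _ => ?_
    rw [mul_smul_comm, smul_mul_assoc, smul_smul, real_inner_comm]
  simp only [polyDunkl_apply, mul_add, Finset.sum_add_distrib, Finset.mul_sum]
  rw [sum_linPoly_mul_polyDerivLin b hp, Finset.sum_comm]
  simp only [h, Finset.sum_sub_distrib, ← Finset.sum_smul]
  rw [add_smul, gammaSum, add_sub_assoc]

/-- If `s` is a closed field of homogeneous polynomials, then `T_η ∑ xᵢ sᵢ` is obtained from `s`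
by the action of `n + 1 + γ - ∑ k(α) σ_α`. -/
theorem polyDunkl_sum_linPoly_mul {n : ℕ} {s : V → polyFun V} (hs : IsLinearMap ℝ s)
    (hmem : ∀ ξ, s ξ ∈ homogSubmodule V n)
    (hsymm : ∀ ξ η, R.polyDunkl β k ξ (s η) = R.polyDunkl β k η (s ξ)) (η : V) :
    R.polyDunkl β k η (∑ i, linPoly (b i) * s (b i)) =
      (((n + 1 : ℕ) : ℂ) + R.gammaSum β k) • s η -
        ∑ α ∈ R.pos β, k α •
          polyComp (rootReflection (α : V)) (s (rootReflection (α : V) η)) := by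
  have h1 : ∑ i, linPoly (b i) * R.polyDunkl β k η (s (b i)) = ((n : ℂ) + R.gammaSum β k) • s η -
      ∑ α ∈ R.pos β, k α • polyComp (rootReflection (α : V)) (s η) := by
    simp only [hsymm η, sum_linPoly_mul_polyDunkl b (hmem η)]
  have h2 : ∑ i, ((⟪η, b i⟫_ℝ : ℝ) : ℂ) • s (b i) = s η := by
    simp only [← sum_inner_smul_of_isLinearMap b hs η, real_inner_comm]
  have h3 (α : R.roots) : ∑ i, (k α * ((⟪(α : V), η⟫_ℝ : ℝ) : ℂ) *
        ((2 * (⟪(α : V), b i⟫_ℝ / ⟪(α : V), α⟫_ℝ) : ℝ) : ℂ)) •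
          polyComp (rootReflection (α : V)) (s (b i)) =
      (k α * ((2 * (⟪(α : V), η⟫_ℝ / ⟪(α : V), α⟫_ℝ) : ℝ) : ℂ)) •
        polyComp (rootReflection (α : V)) (s α) := by
    rw [← sum_inner_smul_of_isLinearMap b hs (α : V), map_sum, Finset.smul_sum]
    refine Finset.sum_congr rfl fun i _ => ?_
    rw [map_smul, smul_smul, real_inner_comm (α : V) (b i)]
    congr 1
    push_cast
    ring
  rw [map_sum]
  simp only [polyDunkl_linPoly_mul, Finset.sum_add_distrib]
  rw [h1, h2, Finset.sum_comm]
  simp only [h3, map_rootReflection_of_isLinearMap hs, map_sub, map_smul, smul_sub,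
    Finset.sum_sub_distrib, smul_smul]
  push_cast
  module

/-- The diagonal action of the reflection group on vector fields. -/
noncomputable def fieldComp (g : R.group) : Module.End ℂ (V → polyFun V) where
  toFun s ξ := polyComp g (s ((g : V ≃ₗᵢ[ℝ] V) ξ))
  map_add' s t := by
    funext ξ
    simp
  map_smul' c s := by
    funext ξ
    simp

theorem eq_zero_of_sum_linPoly_mul_eq_zero (hδ : R.deltaSum β k < ‖1 + R.gammaSum β k‖)
    {n : ℕ} {s : V → polyFun V} (hs : IsLinearMap ℝ s) (hmem : ∀ ξ, s ξ ∈ homogSubmodule V n)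
    (hsymm : ∀ ξ η, R.polyDunkl β k ξ (s η) = R.polyDunkl β k η (s ξ))
    (h0 : ∑ i, linPoly (b i) * s (b i) = 0) : s = 0 := by
  have h := resolvent_sub hδ (Nat.le_add_left 1 n) (fieldComp (R := R)) rfl
    (fun g h v => rfl) s
  rw [← h, show ((((n + 1 : ℕ) : ℂ) + R.gammaSum β k) • s -
      ∑ α ∈ R.pos β, k α • fieldComp (R.refl α) s) = 0 from ?_, map_zero]
  funext η
  have h2 := polyDunkl_sum_linPoly_mul b hs hmem hsymm η
  rw [h0, map_zero] at h2
  simp only [Pi.sub_apply, Pi.smul_apply, Finset.sum_apply, Pi.zero_apply]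
  exact h2.symm

end Euler

end EuclideanRootSystem

section DerivNilpotent

variable {V : Type*} [NormedAddCommGroup V] [InnerProductSpace ℝ V]

/-- All derivatives of order `d` of the polynomial vanish. -/
def DerivNilpotent : ℕ → polyFun V → Prop
  | 0, p => p = 0
  | d + 1, p => ∀ ξ : V, DerivNilpotent d (polyDerivLin ξ p)

theorem DerivNilpotent.zero (d : ℕ) : DerivNilpotent d (0 : polyFun V) := by
  induction d with
  | zero => rfl
  | succ d ih => exact fun ξ => by rwa [map_zero]

theorem DerivNilpotent.succ {d : ℕ} {p : polyFun V} (h : DerivNilpotent d p) :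
    DerivNilpotent (d + 1) p := by
  induction d generalizing p with
  | zero =>
    rw [show p = 0 from h]
    exact .zero 1
  | succ d ih => exact fun ξ => ih (h ξ)

theorem DerivNilpotent.mono {d e : ℕ} (hde : d ≤ e) {p : polyFun V} (h : DerivNilpotent d p) :
    DerivNilpotent e p := by
  induction hde with
  | refl => exact h
  | step _ ih => exact ih.succ

theorem DerivNilpotent.add {d : ℕ} {p q : polyFun V} (hp : DerivNilpotent d p)
    (hq : DerivNilpotent d q) : DerivNilpotent d (p + q) := by
  induction d generalizing p q with
  | zero => rw [show p = 0 from hp, show q = 0 from hq, add_zero]; rfl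
  | succ d ih => exact fun ξ => by rw [map_add]; exact ih (hp ξ) (hq ξ)

theorem DerivNilpotent.smul {d : ℕ} {p : polyFun V} (c : ℂ) (hp : DerivNilpotent d p) :
    DerivNilpotent d (c • p) := by
  induction d generalizing p with
  | zero => rw [show p = 0 from hp, smul_zero]; rfl
  | succ d ih => exact fun ξ => by rw [map_smul]; exact ih (hp ξ)

theorem derivNilpotent_of_mem {n : ℕ} {p : polyFun V} (hp : p ∈ homogSubmodule V n) :
    DerivNilpotent (n + 1) p := by
  induction n generalizing p with
  | zero => exact fun ξ => polyDerivLin_of_mem_zero ξ hp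
  | succ n ih => exact fun ξ => ih (polyDerivLin_mem ξ hp)

theorem exists_derivNilpotent (p : polyFun V) : ∃ d, DerivNilpotent d p := by
  have hp : p ∈ ⨆ n, homogSubmodule V n := by simp [iSup_homogSubmodule]
  refine Submodule.iSup_induction _ (motive := fun p => ∃ d, DerivNilpotent d p) hp
    (fun n p hp => ⟨_, derivNilpotent_of_mem hp⟩) ⟨0, rfl⟩ ?_
  rintro p q ⟨d, hd⟩ ⟨e, he⟩
  exact ⟨max d e, (hd.mono (le_max_left d e)).add (he.mono (le_max_right d e))⟩

theorem eq_smul_one_of_polyDerivLin_eq_zero {p : polyFun V} (h : ∀ ξ, polyDerivLin ξ p = 0) :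
    p = ((p : V → ℂ) 0) • (1 : polyFun V) :=
  polyFun.ext_apply fun x => by
    have h' (x : V) : fderiv ℝ (p : V → ℂ) x = 0 := by
      ext ξ
      rw [← polyDerivLin_apply, h ξ]
      rfl
    rw [is_const_of_fderiv_eq_zero (polyFun.differentiable p) h' x 0]
    simp

theorem isLinearMap_end_apply {s : V → polyFun V} (hs : IsLinearMap ℝ s)
    (L : Module.End ℂ (polyFun V)) : IsLinearMap ℝ fun ξ => L (s ξ) where
  map_add ξ η := by rw [hs.1 ξ η, map_add]
  map_smul c ξ := by rw [hs.2 c ξ, polyFun.coe_real_smul, map_smul, polyFun.coe_real_smul]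

end DerivNilpotent

namespace EuclideanRootSystem

variable {V : Type*} [NormedAddCommGroup V] [InnerProductSpace ℝ V]
  {R : EuclideanRootSystem V} {β : V} {k : R.roots → ℂ}

theorem resolvent_polyComp_mem (m : ℕ) {n : ℕ} {p : polyFun V} (hp : p ∈ homogSubmodule V n) :
    R.resolvent β k m (fun g => polyComp (g : V ≃ₗᵢ[ℝ] V)) p ∈ homogSubmodule V n := by
  rw [resolvent_apply]
  exact Submodule.sum_mem _ fun g _ => Submodule.smul_mem _ _ (polyComp_mem _ hp)

theorem IsIntertwining.polyDunkl_map {L : polyFun V ≃ₗ[ℂ] polyFun V}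
    (hL : R.IsIntertwining β k L) (ξ : V) (p : polyFun V) :
    R.polyDunkl β k ξ (L p) = L (polyDerivLin ξ p) :=
  Subtype.ext ((coe_polyDunkl ξ (L p)).trans (hL.intertwines ξ p))

theorem kernelPart_zero (h : R.IsIntertwining β k (R.intertwiner β k)) (x y : V) :
    R.kernelPart β k 0 x y = 1 := by
  simp [kernelPart, h.map_one]

theorem tupleC_snoc (hβ : ∀ α ∈ R.roots, ⟪α, β⟫_ℝ ≠ 0) (hk : R.IsMultiplicity k) {n : ℕ}
    (h : R.group) (g : Fin n → R.group) :
    R.tupleC β k (Fin.snoc (α := fun _ => R.group) (fun i => g i * h) h) =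
      R.bigC β k (n + 1) h * R.tupleC β k g := by
  have hconj (m : ℕ) (w : R.group) : R.bigC β k m (h⁻¹ * (w * h)) = R.bigC β k m w := by
    rw [← bigC_conj hβ hk m h⁻¹ w, inv_inv, mul_assoc]
  rw [tupleC, Fin.prod_univ_castSucc, mul_comm, tupleC]
  congr 1
  · simp [Fin.snoc]
  · refine Finset.prod_congr rfl fun i _ => ?_
    have hi := i.2
    simp only [Fin.val_castSucc, Nat.succ_lt_succ hi, dif_pos, Fin.snoc_castSucc]
    split_ifs with hi'
    · have : (⟨(i : ℕ) + 1, Nat.succ_lt_succ hi⟩ : Fin (n + 1)) = Fin.castSucc ⟨i + 1, hi'⟩ := rfl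
      rw [this, Fin.snoc_castSucc, mul_inv_rev, mul_assoc, ← mul_assoc _ _ h, hconj]
    · have h1 : (i : ℕ) + 1 = n := by omega
      have : (⟨(i : ℕ) + 1, Nat.succ_lt_succ hi⟩ : Fin (n + 1)) = Fin.last n := Fin.ext h1
      rw [this, Fin.snoc_last, hconj, h1]

variable [FiniteDimensional ℝ V]

/-- The intertwining operator on homogeneous polynomials of degree `n`, extended by zero to
homogeneous polynomials of other degrees. -/
noncomputable def homogIntertwiner (R : EuclideanRootSystem V) (β : V) (k : R.roots → ℂ) :
    ℕ → Module.End ℂ (polyFun V)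
  | 0 =>
    { toFun p := ((p : V → ℂ) 0) • (1 : polyFun V)
      map_add' p q := by simp [add_smul]
      map_smul' c p := by simp [mul_smul] }
  | n + 1 => R.resolvent β k (n + 1) (fun g => polyComp (g : V ≃ₗᵢ[ℝ] V)) ∘ₗ
      ∑ i, LinearMap.mulLeft ℂ (linPoly (stdOrthonormalBasis ℝ V i)) ∘ₗ
        homogIntertwiner R β k n ∘ₗ polyDerivLin (stdOrthonormalBasis ℝ V i)

theorem homogIntertwiner_zero_apply (p : polyFun V) :
    R.homogIntertwiner β k 0 p = ((p : V → ℂ) 0) • (1 : polyFun V) := rfl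

theorem homogIntertwiner_succ_apply (n : ℕ) (p : polyFun V) :
    R.homogIntertwiner β k (n + 1) p =
      R.resolvent β k (n + 1) (fun g => polyComp (g : V ≃ₗᵢ[ℝ] V))
        (∑ i, linPoly (stdOrthonormalBasis ℝ V i) *
          R.homogIntertwiner β k n (polyDerivLin (stdOrthonormalBasis ℝ V i) p)) := by
  simp [homogIntertwiner]

theorem homogIntertwiner_mem (n : ℕ) (p : polyFun V) :
    R.homogIntertwiner β k n p ∈ homogSubmodule V n := by
  induction n generalizing p with
  | zero => exact Submodule.smul_mem _ _ one_mem_homogSubmodule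
  | succ n ih =>
    rw [homogIntertwiner_succ_apply]
    exact resolvent_polyComp_mem _ (Submodule.sum_mem _ fun i _ => linPoly_mul_mem _ (ih _))

/-- A homogeneous polynomial is recovered from its images under the Dunkl operators. -/
theorem resolvent_sum_polyDunkl (hδ : R.deltaSum β k < ‖1 + R.gammaSum β k‖) {n : ℕ}
    {p : polyFun V} (hp : p ∈ homogSubmodule V (n + 1)) :
    R.resolvent β k (n + 1) (fun g => polyComp (g : V ≃ₗᵢ[ℝ] V))
      (∑ i, linPoly (stdOrthonormalBasis ℝ V i) *
        R.polyDunkl β k (stdOrthonormalBasis ℝ V i) p) = p := by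
  rw [sum_linPoly_mul_polyDunkl _ hp]
  exact resolvent_sub hδ (Nat.le_add_left 1 n) (fun g : R.group => polyComp (g : V ≃ₗᵢ[ℝ] V))
    rfl (fun _ _ _ => rfl) p

theorem polyDunkl_homogIntertwiner_succ (hβ : ∀ α ∈ R.roots, ⟪α, β⟫_ℝ ≠ 0)
    (hk : R.IsMultiplicity k) (hδ : R.deltaSum β k < ‖1 + R.gammaSum β k‖) (n : ℕ) (ξ : V)
    (p : polyFun V) : R.polyDunkl β k ξ (R.homogIntertwiner β k (n + 1) p) =
      R.homogIntertwiner β k n (polyDerivLin ξ p) := by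
  have key (n : ℕ) (p : polyFun V) (hsymm : ∀ ξ η : V,
      R.polyDunkl β k ξ (R.homogIntertwiner β k n (polyDerivLin η p)) =
        R.polyDunkl β k η (R.homogIntertwiner β k n (polyDerivLin ξ p))) (ξ : V) :
      R.polyDunkl β k ξ (R.homogIntertwiner β k (n + 1) p) =
        R.homogIntertwiner β k n (polyDerivLin ξ p) := by
    set q := R.homogIntertwiner β k (n + 1) p with hq
    have hqmem : q ∈ homogSubmodule V (n + 1) := homogIntertwiner_mem _ _
    have hl1 := isLinearMap_polyDunkl (R := R) (β := β) (k := k) q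
    have hl2 := isLinearMap_end_apply (isLinearMap_polyDerivLin p) (R.homogIntertwiner β k n)
    have h := eq_zero_of_sum_linPoly_mul_eq_zero (stdOrthonormalBasis ℝ V) hδ
      (s := fun ξ => R.polyDunkl β k ξ q - R.homogIntertwiner β k n (polyDerivLin ξ p)) (n := n)
      (hl1.mk' _ - hl2.mk' _).isLinear
      (fun ξ => Submodule.sub_mem _ (polyDunkl_mem ξ hqmem) (homogIntertwiner_mem _ _))
      (fun ξ η => by rw [map_sub, map_sub, polyDunkl_comm hβ hk, hsymm]) ?_
    · exact sub_eq_zero.1 (congrFun h ξ)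
    · simp only [mul_sub, Finset.sum_sub_distrib]
      rw [sum_linPoly_mul_polyDunkl _ hqmem, hq, homogIntertwiner_succ_apply, sub_eq_zero]
      exact sub_resolvent hβ hk hδ (Nat.le_add_left 1 n)
        (fun g : R.group => polyComp (g : V ≃ₗᵢ[ℝ] V)) rfl (fun _ _ _ => rfl) _
  induction n generalizing ξ p with
  | zero =>
    exact key 0 p (fun ξ η => by
      rw [polyDunkl_of_mem_zero _ (homogIntertwiner_mem _ _),
        polyDunkl_of_mem_zero _ (homogIntertwiner_mem _ _)]) ξ
  | succ n ih => exact key (n + 1) p (fun ξ η => by rw [ih, ih, polyDerivLin_comm]) ξ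

theorem homogIntertwiner_of_lt {m n : ℕ} (hmn : m < n) {p : polyFun V}
    (hp : p ∈ homogSubmodule V n) : R.homogIntertwiner β k m p = 0 := by
  induction m generalizing n p with
  | zero =>
    have := hp 0 0
    rw [homogIntertwiner_zero_apply]
    simp [hmn.ne'] at this
    simp [this]
  | succ m ih =>
    obtain ⟨n, rfl⟩ : ∃ n', n = n' + 1 := ⟨n - 1, by omega⟩
    rw [homogIntertwiner_succ_apply]
    simp only [ih (Nat.lt_of_succ_lt_succ hmn) (polyDerivLin_mem _ hp), mul_zero,
      Finset.sum_const_zero, map_zero]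

theorem homogIntertwiner_of_derivNilpotent {d n : ℕ} (hdn : d ≤ n) {p : polyFun V}
    (hp : DerivNilpotent d p) : R.homogIntertwiner β k n p = 0 := by
  induction d generalizing n p with
  | zero => rw [show p = 0 from hp, map_zero]
  | succ d ih =>
    obtain ⟨n, rfl⟩ : ∃ n', n = n' + 1 := ⟨n - 1, by omega⟩
    rw [homogIntertwiner_succ_apply]
    simp only [ih (Nat.le_of_succ_le_succ hdn) (hp _), mul_zero,
      Finset.sum_const_zero, map_zero]

theorem finsum_homogIntertwiner {d : ℕ} {p : polyFun V} (hp : DerivNilpotent d p) :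
    ∑ᶠ n, R.homogIntertwiner β k n p = ∑ n ∈ Finset.range d, R.homogIntertwiner β k n p := by
  refine finsum_eq_sum_of_support_subset _ fun n hn => ?_
  by_contra h
  exact hn (homogIntertwiner_of_derivNilpotent (by simpa using h) hp)

/-- The intertwining operator, as the sum of its homogeneous parts. -/
noncomputable def sumIntertwiner (R : EuclideanRootSystem V) (β : V) (k : R.roots → ℂ) :
    Module.End ℂ (polyFun V) where
  toFun p := ∑ᶠ n, R.homogIntertwiner β k n p
  map_add' p q := by
    obtain ⟨d, hd⟩ := exists_derivNilpotent p
    obtain ⟨e, he⟩ := exists_derivNilpotent q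
    replace hd := hd.mono (le_max_left d e)
    replace he := he.mono (le_max_right d e)
    rw [finsum_homogIntertwiner hd, finsum_homogIntertwiner he,
      finsum_homogIntertwiner (hd.add he)]
    simp only [map_add, Finset.sum_add_distrib]
  map_smul' c p := by
    obtain ⟨d, hd⟩ := exists_derivNilpotent p
    rw [finsum_homogIntertwiner hd, finsum_homogIntertwiner (hd.smul c), RingHom.id_apply,
      Finset.smul_sum]
    simp only [map_smul]

theorem sumIntertwiner_apply {d : ℕ} {p : polyFun V} (hp : DerivNilpotent d p) :
    R.sumIntertwiner β k p = ∑ n ∈ Finset.range d, R.homogIntertwiner β k n p :=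
  finsum_homogIntertwiner hp

theorem sumIntertwiner_mem {n : ℕ} {p : polyFun V} (hp : p ∈ homogSubmodule V n) :
    R.sumIntertwiner β k p ∈ homogSubmodule V n := by
  rw [sumIntertwiner_apply (derivNilpotent_of_mem hp), Finset.sum_range_succ,
    Finset.sum_eq_zero fun m hm => homogIntertwiner_of_lt (Finset.mem_range.1 hm) hp, zero_add]
  exact homogIntertwiner_mem _ _

theorem sumIntertwiner_one : R.sumIntertwiner β k 1 = 1 := by
  rw [sumIntertwiner_apply (derivNilpotent_of_mem one_mem_homogSubmodule)]
  simp [homogIntertwiner_zero_apply]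

section Bijective

theorem polyDunkl_sumIntertwiner (hβ : ∀ α ∈ R.roots, ⟪α, β⟫_ℝ ≠ 0) (hk : R.IsMultiplicity k)
    (hδ : R.deltaSum β k < ‖1 + R.gammaSum β k‖) (ξ : V) (p : polyFun V) :
    R.polyDunkl β k ξ (R.sumIntertwiner β k p) = R.sumIntertwiner β k (polyDerivLin ξ p) := by
  obtain ⟨d, hd⟩ := exists_derivNilpotent p
  rw [sumIntertwiner_apply hd.succ, sumIntertwiner_apply (hd.succ ξ), Finset.sum_range_succ',
    map_add, map_sum, polyDunkl_of_mem_zero _ (homogIntertwiner_mem _ _), add_zero]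
  exact Finset.sum_congr rfl fun n _ => polyDunkl_homogIntertwiner_succ hβ hk hδ n ξ p

theorem sumIntertwiner_injective (hβ : ∀ α ∈ R.roots, ⟪α, β⟫_ℝ ≠ 0) (hk : R.IsMultiplicity k)
    (hδ : R.deltaSum β k < ‖1 + R.gammaSum β k‖) : Function.Injective (R.sumIntertwiner β k) := by
  refine (injective_iff_map_eq_zero _).2 fun p hp => ?_
  obtain ⟨d, hd⟩ := exists_derivNilpotent p
  induction d generalizing p with
  | zero => exact hd
  | succ d ih =>
    have h (ξ : V) : polyDerivLin ξ p = 0 := by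
      refine ih _ ?_ (hd ξ)
      rw [← polyDunkl_sumIntertwiner hβ hk hδ, hp, map_zero]
    have h' := eq_smul_one_of_polyDerivLin_eq_zero h
    rw [h', map_smul, sumIntertwiner_one] at hp
    rw [h', hp]

theorem exists_sumIntertwiner_eq (hβ : ∀ α ∈ R.roots, ⟪α, β⟫_ℝ ≠ 0) (hk : R.IsMultiplicity k)
    (hδ : R.deltaSum β k < ‖1 + R.gammaSum β k‖) {n : ℕ} {q : polyFun V}
    (hq : q ∈ homogSubmodule V n) :
    ∃ p ∈ homogSubmodule V n, R.sumIntertwiner β k p = q := by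
  have hinj := sumIntertwiner_injective hβ hk hδ
  induction n generalizing q with
  | zero =>
    refine ⟨q, hq, ?_⟩
    rw [eq_smul_one_of_mem_zero hq, map_smul, sumIntertwiner_one]
  | succ n ih =>
    choose r hrmem hr using fun ξ => ih (polyDunkl_mem (R := R) (β := β) (k := k) ξ hq)
    have hsymm (ξ η : V) : polyDerivLin ξ (r η) = polyDerivLin η (r ξ) := hinj <| by
      rw [← polyDunkl_sumIntertwiner hβ hk hδ, ← polyDunkl_sumIntertwiner hβ hk hδ, hr, hr,
        polyDunkl_comm hβ hk]
    have hlin : IsLinearMap ℝ r := by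
      have hT := isLinearMap_polyDunkl (R := R) (β := β) (k := k) q
      refine ⟨fun ξ η => hinj ?_, fun c ξ => hinj ?_⟩
      · rw [map_add, hr, hr, hr, hT.map_add]
      · rw [polyFun.coe_real_smul, map_smul, hr, hr, hT.map_smul, polyFun.coe_real_smul]
    let b := stdOrthonormalBasis ℝ V
    let p : polyFun V := ((n : ℂ) + 1)⁻¹ • ∑ i, linPoly (b i) * r (b i)
    have hn : (n : ℂ) + 1 ≠ 0 := by exact_mod_cast n.succ_ne_zero
    have hp : p ∈ homogSubmodule V (n + 1) := Submodule.smul_mem _ _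
      (Submodule.sum_mem _ fun i _ => linPoly_mul_mem _ (hrmem _))
    have hderiv (η : V) : polyDerivLin η p = r η := by
      have h1 : ∑ i, ((⟪η, b i⟫_ℝ : ℝ) : ℂ) • r (b i) = r η := by
        simp only [← sum_inner_smul_of_isLinearMap b hlin η, real_inner_comm]
      rw [map_smul, map_sum]
      simp only [polyDerivLin_linPoly_mul, Finset.sum_add_distrib, h1, hsymm η]
      rw [sum_linPoly_mul_polyDerivLin b (hrmem η),
        show (n : ℂ) • r η + r η = ((n : ℂ) + 1) • r η by module,
        inv_smul_smul₀ hn]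
    refine ⟨p, hp, sub_eq_zero.1 ?_⟩
    rw [← resolvent_sum_polyDunkl hδ
      (Submodule.sub_mem _ (sumIntertwiner_mem (β := β) (k := k) hp) hq)]
    simp only [map_sub, polyDunkl_sumIntertwiner hβ hk hδ, hderiv, hr, sub_self, mul_zero,
      Finset.sum_const_zero, map_zero]

theorem sumIntertwiner_bijective (hβ : ∀ α ∈ R.roots, ⟪α, β⟫_ℝ ≠ 0) (hk : R.IsMultiplicity k)
    (hδ : R.deltaSum β k < ‖1 + R.gammaSum β k‖) : Function.Bijective (R.sumIntertwiner β k) := by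
  refine ⟨sumIntertwiner_injective hβ hk hδ, fun q => ?_⟩
  have hq : q ∈ ⨆ n, homogSubmodule V n := by simp [iSup_homogSubmodule]
  refine Submodule.iSup_induction _ (motive := fun q => ∃ p, R.sumIntertwiner β k p = q) hq
    (fun n q hq => ?_) ⟨0, map_zero _⟩ ?_
  · obtain ⟨p, -, h⟩ := exists_sumIntertwiner_eq hβ hk hδ hq
    exact ⟨p, h⟩
  · rintro _ _ ⟨p, rfl⟩ ⟨q, rfl⟩
    exact ⟨p + q, map_add _ p q⟩

theorem isIntertwining_sumIntertwiner (hβ : ∀ α ∈ R.roots, ⟪α, β⟫_ℝ ≠ 0) (hk : R.IsMultiplicity k)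
    (hδ : R.deltaSum β k < ‖1 + R.gammaSum β k‖) : R.IsIntertwining β k
    (LinearEquiv.ofBijective (R.sumIntertwiner β k) (sumIntertwiner_bijective hβ hk hδ)) where
  map_homog _ _ hp := sumIntertwiner_mem hp
  map_one := sumIntertwiner_one
  intertwines ξ p := by
    rw [← coe_polyDunkl]
    exact congrArg Subtype.val (polyDunkl_sumIntertwiner hβ hk hδ ξ p)

end Bijective

section Uniqueness

variable {L L' : polyFun V ≃ₗ[ℂ] polyFun V}

theorem IsIntertwining.map_eq_resolvent (hL : R.IsIntertwining β k L)
    (hδ : R.deltaSum β k < ‖1 + R.gammaSum β k‖) {n : ℕ} {p : polyFun V}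
    (hp : p ∈ homogSubmodule V (n + 1)) :
    L p = R.resolvent β k (n + 1) (fun g => polyComp (g : V ≃ₗᵢ[ℝ] V))
      (∑ i, linPoly (stdOrthonormalBasis ℝ V i) *
        L (polyDerivLin (stdOrthonormalBasis ℝ V i) p)) := by
  rw [← resolvent_sum_polyDunkl hδ (hL.map_homog _ _ hp)]
  simp only [hL.polyDunkl_map]

theorem IsIntertwining.unique (hL : R.IsIntertwining β k L) (hL' : R.IsIntertwining β k L')
    (hδ : R.deltaSum β k < ‖1 + R.gammaSum β k‖) : L = L' := by
  ext1 p
  have hp : p ∈ ⨆ n, homogSubmodule V n := by simp [iSup_homogSubmodule]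
  refine Submodule.iSup_induction _ (motive := fun p => L p = L' p) hp
    (fun n p hp => ?_) (by simp) (fun p q hp hq => by rw [map_add, map_add, hp, hq])
  induction n generalizing p with
  | zero =>
    rw [eq_smul_one_of_mem_zero hp, map_smul, map_smul, hL.map_one, hL'.map_one]
  | succ n ih =>
    rw [hL.map_eq_resolvent hδ hp, hL'.map_eq_resolvent hδ hp]
    simp only [ih _ (polyDerivLin_mem _ hp)]

theorem IsIntertwining.map_linPoly_pow (hL : R.IsIntertwining β k L)
    (hδ : R.deltaSum β k < ‖1 + R.gammaSum β k‖) (n : ℕ) (y : V) :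
    L (linPoly y ^ (n + 1)) = ((n : ℂ) + 1) •
      R.resolvent β k (n + 1) (fun g => polyComp (g : V ≃ₗᵢ[ℝ] V))
        (linPoly y * L (linPoly y ^ n)) := by
  rw [hL.map_eq_resolvent hδ (linPoly_pow_mem y (n + 1)), ← map_smul]
  congr 1
  rw [← sum_inner_smul_of_isLinearMap (stdOrthonormalBasis ℝ V) isLinearMap_linPoly y,
    Finset.sum_mul, Finset.smul_sum,
    sum_inner_smul_of_isLinearMap (stdOrthonormalBasis ℝ V) isLinearMap_linPoly y]
  refine Finset.sum_congr rfl fun i _ => ?_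
  rw [polyDerivLin_linPoly_pow, map_smul, mul_smul_comm, smul_mul_assoc, smul_smul]

end Uniqueness

section Kernel

theorem isIntertwining_intertwiner (hβ : ∀ α ∈ R.roots, ⟪α, β⟫_ℝ ≠ 0) (hk : R.IsMultiplicity k)
    (hδ : R.deltaSum β k < ‖1 + R.gammaSum β k‖) :
    R.IsIntertwining β k (R.intertwiner β k) :=
  Classical.epsilon_spec ⟨_, isIntertwining_sumIntertwiner hβ hk hδ⟩

theorem kernelPart_succ (h : R.IsIntertwining β k (R.intertwiner β k))
    (hδ : R.deltaSum β k < ‖1 + R.gammaSum β k‖) (n : ℕ) (x y : V) :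
    R.kernelPart β k (n + 1) x y = ∑ g : R.group, R.bigC β k (n + 1) g *
      (((⟪(g : V ≃ₗᵢ[ℝ] V) x, y⟫_ℝ : ℝ) : ℂ) *
        R.kernelPart β k n ((g : V ≃ₗᵢ[ℝ] V) x) y) := by
  have hn : (n : ℂ) + 1 ≠ 0 := by exact_mod_cast n.succ_ne_zero
  simp only [kernelPart, h.map_linPoly_pow hδ, resolvent_apply, Nat.factorial_succ]
  simp [Finset.mul_sum]
  refine Finset.sum_congr rfl fun g _ => ?_
  field_simp

theorem sum_snoc_mul {G M : Type*} [Group G] [Fintype G] [AddCommMonoid M] {n : ℕ}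
    (F : (Fin (n + 1) → G) → M) :
    ∑ g, F g = ∑ h : G, ∑ g : Fin n → G, F (Fin.snoc (α := fun _ => G) (fun i => g i * h) h) := by
  rw [← Equiv.sum_comp (Fin.snocEquiv fun _ : Fin (n + 1) => G), Fintype.sum_prod_type]
  refine Finset.sum_congr rfl fun h _ => ?_
  rw [← Equiv.sum_comp (Equiv.piCongrRight fun _ : Fin n => Equiv.mulRight h)]
  rfl

theorem kernelPart_eq_sum (hβ : ∀ α ∈ R.roots, ⟪α, β⟫_ℝ ≠ 0) (hk : R.IsMultiplicity k)
    (hδ : R.deltaSum β k < ‖1 + R.gammaSum β k‖) (n : ℕ) (x y : V) :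
    R.kernelPart β k n x y = ∑ g : Fin n → R.group,
      R.tupleC β k g * ∏ j : Fin n, ((⟪(g j : V ≃ₗᵢ[ℝ] V) x, y⟫_ℝ : ℝ) : ℂ) := by
  have hL := isIntertwining_intertwiner hβ hk hδ
  induction n generalizing x with
  | zero =>
    rw [kernelPart_zero hL]
    simp [tupleC]
  | succ n ih =>
    rw [kernelPart_succ hL hδ, sum_snoc_mul]
    refine Finset.sum_congr rfl fun h _ => ?_
    rw [ih, Finset.mul_sum, Finset.mul_sum]
    refine Finset.sum_congr rfl fun g _ => ?_
    rw [tupleC_snoc hβ hk, Fin.prod_univ_castSucc]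
    simp only [Fin.snoc_castSucc, Fin.snoc_last, Subgroup.coe_mul, LinearIsometryEquiv.coe_mul,
      Function.comp_apply]
    ring

end Kernel

end EuclideanRootSystem
theorem corollary3p3 {V : Type*} [NormedAddCommGroup V] [InnerProductSpace ℝ V]
    [FiniteDimensional ℝ V] (R : EuclideanRootSystem V) (β : V)
    (hβ : ∀ α ∈ R.roots, ⟪α, β⟫_ℝ ≠ 0) (k : R.roots → ℂ) (hk : R.IsMultiplicity k)
    (hδ : R.deltaSum β k < ‖1 + R.gammaSum β k‖) :
    (∃! L : polyFun V ≃ₗ[ℂ] polyFun V, R.IsIntertwining β k L) ∧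
    (∀ n : ℕ, 1 ≤ n → ∀ g : R.group, Summable (R.cTerm β k n g)) ∧
    ∀ n : ℕ, 1 ≤ n → ∀ x y : V,
      R.kernelPart β k n x y =
        ∑ g : Fin n → R.group,
          R.tupleC β k g * ∏ j : Fin n, ((⟪(g j : V ≃ₗᵢ[ℝ] V) x, y⟫_ℝ : ℝ) : ℂ) :=
  ⟨⟨_, EuclideanRootSystem.isIntertwining_sumIntertwiner hβ hk hδ,
      fun _ hL => hL.unique (EuclideanRootSystem.isIntertwining_sumIntertwiner hβ hk hδ) hδ⟩,
    fun _ hn g => EuclideanRootSystem.summable_cTerm hδ hn g,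
    fun n _ x y => EuclideanRootSystem.kernelPart_eq_sum hβ hk hδ n x y⟩
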